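/- Let $T=\mathbb F_2^{\oplus\mathbb N}$ be the set of finitely supported $0$-$1$ sequences, with standard basis vectors $e_i$, and let $\Gamma$ be the group of permutations of $T$ generated by the finitely supported permutations of the coordinate set $\mathbb N$ and the bit-flips $x\mapsto x+e_i$. It acts on $\mathbb F_2^T$ by $\tau^\gamma((\omega_t)_t)=(\omega_{\gamma(t)})_t$. Let $\mathrm{Pr}^\Gamma\mathbb F_2^T$ be the set of $\Gamma$-invariant Borel probability measures on $\mathbb F_2^T$, and for $\Omega\subseteq\mathbb F_2^T$ let $\mathrm{Pr}^\Gamma\Omega$ be the set of those that are concentrated on $\Omega$. Let $\Omega_2\subseteq\mathbb F_2^T$ be the closed set of all $g$ with $\sum_{v\in F}g_v=0$ for every $2$-face $F=\{x,\,x+e_i,\,x+e_j,\,x+e_i+e_j\}$, $i\ne j$. The vague topology is the weak topology of convergence against continuous functions. For $\mu,\nu\in\mathrm{Pr}^\Gamma\mathbb F_2^T$ and a reference index $v\in T$, let $\rho(\mu,\nu)=\inf_\lambda\lambda\{(\omega,\eta):\omega_v\neq\eta_v\}$, where $\lambda$ runs over the joinings of $\mu$ and $\nu$, i.e. the probability measures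 on $\mathbb F_2^T\times\mathbb F_2^T$ invariant under the diagonal action of $\Gamma$ with first marginal $\mu$ and second marginal $\nu$. For $p\in[0,1]$ let $\mu_p$ be the law of $\big(g_0+\sum_i v_iz_i\big)_{v\in T}$, where $g_0$ is uniform on $\mathbb F_2$, the $z_i$ take the value $1$ with probability $p$ and $0$ with probability $1-p$, and $g_0,z_0,z_1,\dots$ are independent (these are Aldous' random-walk examples over $\mathbb F_2$). Let $\delta_{\mathbf 0},\delta_{\mathbf 1}$ be the point masses at the two constant configurations. Then: 1. For every choice of the reference index $v$, the joining neighbourhood basis of $\mathrm{Pr}^\Gamma\Omega_2$ in $\mathrm{Pr}^\Gamma\mathbb F_2^T$ is strictly stronger than the vague one. That is, every vague neighbourhood of $\mathrm{Pr}^\Gamma\Omega_2$ in $\mathrm{Pr}^\Gamma\mathbb F_2^T$ contains $\{\mu\in\mathrm{Pr}^\Gamma\mathbb F_2^T:\ \exists\,\nu\in\mathrm{Pr}^\Gamma\Omega_2,\ \rho(\mu,\nu)<\varepsilon\}$ for some $\varepsilon>0$, but for some $\varepsilon>0$ the latter set is not a vague neighbourhood of $\mathrm{Pr}^\Gamma\Omega_2$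 in $\mathrm{Pr}^\Gamma\mathbb F_2^T$. 2. $\mathrm{Pr}^\Gamma\Omega_2$ consists exactly of the mixtures $a\,\delta_{\mathbf 0}+b\,\delta_{\mathbf 1}+\int_{[0,1]}\mu_p\,dm(p)$, with $a,b\ge0$ and $m$ a positive Borel measure on $[0,1]$ such that $a+b+m([0,1])=1$. 3. The set of extreme points of $\mathrm{Pr}^\Gamma\Omega_2$ is $\{\delta_{\mathbf 0},\delta_{\mathbf 1}\}\cup\{\mu_p:0<p\le1\}$. 4. In the vague topology, this set of extreme points has exactly one non-ergodic cluster point, namely $\tfrac12\delta_{\mathbf 0}+\tfrac12\delta_{\mathbf 1}$. 5. The extreme points of $\mathrm{Pr}^\Gamma\Omega_2$ are not vaguely dense in it, so $\mathrm{Pr}^\Gamma\Omega_2$ is not the Poulsen simplex. -/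

import Mathlib

open MeasureTheory ProbabilityTheory Filter Topology
open scoped NNReal ENNReal unitInterval

noncomputable section

namespace CubeExch

/-! ### The infinite discrete cube and its isometries -/

/-- The vertex set `𝔽₂^{⊕ℕ}`: finitely supported `0-1` sequences. -/
abbrev Cube : Type := ℕ →₀ ZMod 2

/-- The configuration space `𝔽₂^{𝔽₂^{⊕ℕ}}`, with the product topology and σ-algebra. -/
abbrev Config : Type := Cube → ZMod 2

/-- The `i`-th bit-flip `x ↦ x + eᵢ`. -/
def bitFlip (i : ℕ) : Equiv.Perm Cube := Equiv.addRight (Finsupp.single i 1)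

/-- The permutation of the cube induced by a permutation of the coordinate set `ℕ`. -/
def permuteCoords (π : Equiv.Perm ℕ) : Equiv.Perm Cube := Finsupp.equivCongrLeft π

/-- The isometry group of the infinite-dimensional discrete cube: the group of permutations of
`Cube` generated by the finitely supported coordinate permutations and all bit-flips. -/
def cubeIsom : Subgroup (Equiv.Perm Cube) :=
  Subgroup.closure
    ({g | ∃ π : Equiv.Perm ℕ, {i | π i ≠ i}.Finite ∧ g = permuteCoords π} ∪ Set.range bitFlip)

/-- The coordinate-permuting map `(ω_t)_t ↦ (ω_{γ t})_t` on configurations. -/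
def shift (γ : Equiv.Perm Cube) (ω : Config) : Config := fun t => ω (γ t)

/-! ### Exchangeable measures, ergodicity, extreme points -/

/-- The cube-exchangeable probability measures on `Config`. -/
def exch : Set (ProbabilityMeasure Config) :=
  {μ | ∀ γ ∈ cubeIsom, (μ : Measure Config).map (shift γ) = μ}

/-- The cube-exchangeable probability measures that are concentrated on `Ω`. -/
def exchOn (Ω : Set Config) : Set (ProbabilityMeasure Config) :=
  {μ ∈ exch | ∀ᵐ ω ∂(μ : Measure Config), ω ∈ Ω}

/-- Every event that is invariant under the isometry group has probability `0` or `1`. -/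
def IsErgodic (μ : ProbabilityMeasure Config) : Prop :=
  ∀ A : Set Config, MeasurableSet A → (∀ γ ∈ cubeIsom, shift γ ⁻¹' A = A) →
    (μ : Measure Config) A = 0 ∨ (μ : Measure Config) A = 1

/-- The extreme points of a set of probability measures (for convex combinations of measures). -/
def extremeMeasures (S : Set (ProbabilityMeasure Config)) : Set (ProbabilityMeasure Config) :=
  {μ | (μ : Measure Config) ∈
    Set.extremePoints ℝ≥0 ((fun ν : ProbabilityMeasure Config => (ν : Measure Config)) '' S)}

/-! ### Joinings and the joining distance -/

/-- `lam` is a joining of `μ` and `ν`: a probability measure on pairs of configurations that is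
invariant under the diagonal action and has marginals `μ` and `ν`. -/
structure IsJoining (lam : ProbabilityMeasure (Config × Config))
    (μ ν : ProbabilityMeasure Config) : Prop where
  invariant : ∀ γ ∈ cubeIsom,
    (lam : Measure (Config × Config)).map (Prod.map (shift γ) (shift γ)) = lam
  map_fst : (lam : Measure (Config × Config)).map Prod.fst = μ
  map_snd : (lam : Measure (Config × Config)).map Prod.snd = ν

/-- The joining distance with reference index `v`: the infimum, over all joinings of `μ` and `ν`,
of the probability that the two configurations differ at `v`. -/
def dbar (v : Cube) (μ ν : ProbabilityMeasure Config) : ℝ≥0∞ :=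
  ⨅ (lam : ProbabilityMeasure (Config × Config)) (_ : IsJoining lam μ ν),
    (lam : Measure (Config × Config)) {q | q.1 v ≠ q.2 v}

/-- The joining neighbourhoods of `S`: the filter on probability measures generated by the sets
of all exchangeable measures at joining distance less than `ε` from some member of `S`. -/
def joiningNhds (v : Cube) (S : Set (ProbabilityMeasure Config)) :
    Filter (ProbabilityMeasure Config) :=
  ⨅ (ε : ℝ≥0∞) (_ : 0 < ε), 𝓟 {μ ∈ exch | ∃ ν ∈ S, dbar v μ ν < ε}

/-- The vague neighbourhoods of `S` among the exchangeable measures. -/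
def vagueNhds (S : Set (ProbabilityMeasure Config)) : Filter (ProbabilityMeasure Config) :=
  𝓝ˢ S ⊓ 𝓟 exch

/-! ### Configurations with vanishing face sums -/

/-- The face through `x` in the coordinate directions of `s`; it has dimension `s.card`. -/
def face (x : Cube) (s : Finset ℕ) : Finset Cube :=
  s.powerset.image fun a => x + ∑ i ∈ a, Finsupp.single i 1

/-- The configurations whose sum over every `r`-face is zero. -/
def faceSumZero (r : ℕ) : Set Config :=
  {g | ∀ (x : Cube) (s : Finset ℕ), s.card = r → ∑ v ∈ face x s, g v = 0}

/-! ### Random walk examples -/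

/-- The configuration `g_v = g₀ + ∑ᵢ vᵢ zᵢ` of a walk with starting point `g₀` and steps `z`. -/
def walkConfig (w : ZMod 2 × (ℕ → ZMod 2)) : Config :=
  fun v => w.1 + v.sum fun i a => a * w.2 i

theorem measurable_walkConfig : Measurable walkConfig := by
  refine measurable_pi_lambda _ fun v => Continuous.measurable ?_
  unfold walkConfig Finsupp.sum
  fun_prop

/-- The random walk example over `𝔽₂`: the starting point is uniform, and the steps
are independent of it and of each other, with the law that gives mass `p` to `1` and
`1 - p` to `0`. -/
def randomWalk (p : I) : ProbabilityMeasure Config :=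
  ⟨((uniformOn (Set.univ : Set (ZMod 2))).prod
      (Measure.infinitePi fun _ : ℕ => bernoulliMeasure (1 : ZMod 2) 0 p)).map walkConfig,
    haveI : IsProbabilityMeasure (uniformOn (Set.univ : Set (ZMod 2))) :=
      isProbabilityMeasure_uniformOn Set.finite_univ Set.univ_nonempty
    Measure.isProbabilityMeasure_map measurable_walkConfig.aemeasurable⟩

/-- The point mass at the constant configuration `c`. -/
def diracConst (c : ZMod 2) : ProbabilityMeasure Config :=
  ⟨Measure.dirac fun _ => c, inferInstance⟩

/-- The measure `½ δ_𝟎 + ½ δ_𝟏`. -/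
def halfHalf : ProbabilityMeasure Config :=
  ⟨(2⁻¹ : ℝ≥0∞) • (diracConst 0 : Measure Config) + (2⁻¹ : ℝ≥0∞) • (diracConst 1 : Measure Config),
    ⟨by simp [ENNReal.inv_two_add_inv_two]⟩⟩

end CubeExch

end

open CubeExch

namespace CubeExch

/-! ### The action of the isometry group -/

/-! A configuration whose `2`-face sums vanish is affine, `g_v = g_0 + ∑ v_i z_i`, so a measure on
`faceSumZero 2` amounts to a law of the pair `(g_0, z)`. Coordinate permutations permute `z`; hence
`z` is exchangeable, and de Finetti's theorem makes it a mixture of Bernoulli sequences. The `i`-th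
flip maps `(c, z)` to `(c + z_i, z)`; hence wherever `z ≠ 0`, the starting point is a fair coin
independent of `z`. Where `z = 0` nothing constrains it, which leaves two free atoms, the constants.
This gives `mem_exchOn_iff_mixture`.

For `p > 0`, the mean square deviation of the step frequency from `p` is an affine function of the
measure, nonnegative, and zero only at `randomWalk p`; so this walk is extreme. Conversely, an
extreme mixture is proportional to each of its nonzero parts, and splitting the frequency law at its
mean shows that it is a point mass.

Extreme points are ergodic, and `p ↦ randomWalk p` is continuous on the compact interval. The
closure of the extreme points therefore adds at most the limit `p = 0`, the fair mixture of the
constants. Any other nontrivial mixture of the constants is outside the closure.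

Small joining distance implies vague closeness by compactness of the space of joinings
(`joiningNhds_le_vagueNhds`). The converse fails for the pointwise product of two independent walks.
As `p → 0` it tends to a member of the simplex, but for every small `p > 0` some parallelogram, with
sides long enough for the step parities to mix, has nonzero sum with probability at least `1/32`. A
joining with an affine configuration would bound this, uniformly over all parallelograms, by four
times the disagreement probability. -/

theorem continuous_shift (γ : Equiv.Perm Cube) : Continuous (shift γ) := by
  unfold shift; fun_prop

theorem measurable_shift (γ : Equiv.Perm Cube) : Measurable (shift γ) :=
  (continuous_shift γ).measurable

theorem shift_one : shift 1 = id := rfl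

theorem shift_mul (γ δ : Equiv.Perm Cube) : shift (γ * δ) = shift δ ∘ shift γ := rfl

/-- Invariance passes to products and inverses. All coordinate permutations are allowed in `hπ`,
since i.i.d. steps are invariant under each of them. -/
theorem map_shift_eq_of_generators {μ : Measure Config}
    (hπ : ∀ π : Equiv.Perm ℕ, μ.map (shift (permuteCoords π)) = μ)
    (hf : ∀ i, μ.map (shift (bitFlip i)) = μ) {γ : Equiv.Perm Cube} (hγ : γ ∈ cubeIsom) :
    μ.map (shift γ) = μ := by
  induction hγ using Subgroup.closure_induction with
  | mem g hg =>
    rcases hg with ⟨π, -, rfl⟩ | ⟨i, rfl⟩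
    · exact hπ π
    · exact hf i
  | one => simp [shift_one]
  | mul γ δ _ _ h₁ h₂ =>
    rw [shift_mul, ← Measure.map_map (measurable_shift _) (measurable_shift _), h₁, h₂]
  | inv γ _ h =>
    conv_lhs => rw [← h]
    rw [Measure.map_map (measurable_shift _) (measurable_shift _), ← shift_mul, mul_inv_cancel,
      shift_one, Measure.map_id]

/-- Translations are products of bit-flips. They make the group transitive on vertices, so
disagreement probabilities do not depend on the reference index. -/
theorem addRight_mem_cubeIsom (v : Cube) : Equiv.addRight v ∈ cubeIsom := by
  induction v using Finsupp.induction_linear with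
  | zero =>
    convert cubeIsom.one_mem using 1
    ext x : 1
    simp
  | add f g hf hg =>
    convert cubeIsom.mul_mem hg hf using 1
    ext x : 1
    simp [add_assoc]
  | single i a =>
    rcases (show a = 0 ∨ a = 1 by revert a; decide) with rfl | rfl
    · convert cubeIsom.one_mem using 1
      ext x : 1
      simp
    · exact Subgroup.subset_closure (Or.inr ⟨i, rfl⟩)

theorem swap_mem_cubeIsom (i j : ℕ) : permuteCoords (Equiv.swap i j) ∈ cubeIsom := by
  refine Subgroup.subset_closure (Or.inl ⟨_, ?_, rfl⟩)
  refine (Set.toFinite {i, j}).subset fun k hk => ?_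
  by_contra h
  simp only [Set.mem_insert_iff, Set.mem_singleton_iff, not_or] at h
  exact hk (Equiv.swap_apply_of_ne_of_ne h.1 h.2)

theorem bitFlip_mem_cubeIsom (i : ℕ) : bitFlip i ∈ cubeIsom :=
  Subgroup.subset_closure (Or.inr ⟨i, rfl⟩)

theorem measure_preimage_shift {μ : ProbabilityMeasure Config} (hμ : μ ∈ exch)
    {γ : Equiv.Perm Cube} (hγ : γ ∈ cubeIsom) {A : Set Config} (hA : MeasurableSet A) :
    (μ : Measure Config) (shift γ ⁻¹' A) = (μ : Measure Config) A := by
  conv_rhs => rw [← hμ γ hγ]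
  rw [Measure.map_apply (measurable_shift γ) hA]

/-! ### Closedness -/

/-- Portmanteau theorem: a clopen set has empty frontier. -/
theorem continuous_measure_of_isClopen {X : Type*} [TopologicalSpace X] [MeasurableSpace X]
    [OpensMeasurableSpace X] [HasOuterApproxClosed X] {E : Set X} (hE : IsClopen E) :
    Continuous fun μ : ProbabilityMeasure X => (μ : Measure X) E := by
  refine continuous_iff_continuousAt.2 fun μ => ?_
  exact ProbabilityMeasure.tendsto_measure_of_null_frontier_of_tendsto' tendsto_id
    (by simp [hE.frontier_eq])

theorem isClosed_invariant {X : Type*} [TopologicalSpace X] [MeasurableSpace X]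
    [BorelSpace X] [HasOuterApproxClosed X] {f : X → X} (hf : Continuous f) :
    IsClosed {μ : ProbabilityMeasure X | (μ : Measure X).map f = μ} := by
  have h : {μ : ProbabilityMeasure X | (μ : Measure X).map f = μ} =
      {μ : ProbabilityMeasure X | μ.map hf.measurable.aemeasurable = μ} := by
    ext μ
    simp only [Set.mem_ofPred_eq]
    rw [← ProbabilityMeasure.toMeasure_injective.eq_iff, ProbabilityMeasure.toMeasure_map]
  rw [h]
  exact isClosed_eq (ProbabilityMeasure.continuous_map hf) continuous_id

theorem isClosed_exch : IsClosed exch := by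
  simp only [exch, Set.ofPred_forall]
  exact isClosed_iInter fun γ => isClosed_iInter fun _ => isClosed_invariant (continuous_shift γ)

theorem isClopen_faceSum (x : Cube) (s : Finset ℕ) :
    IsClopen {g : Config | ∑ v ∈ face x s, g v = 0} :=
  (isClopen_discrete {0}).preimage
    (f := fun g : Config => ∑ v ∈ face x s, g v) (by fun_prop)

theorem faceSumZero_eq_iInter (r : ℕ) :
    faceSumZero r = ⋂ (x : Cube) (s : Finset ℕ) (_ : s.card = r),
      {g : Config | ∑ v ∈ face x s, g v = 0} := by
  ext; simp [faceSumZero]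

theorem isClosed_faceSumZero (r : ℕ) : IsClosed (faceSumZero r) := by
  rw [faceSumZero_eq_iInter]
  exact isClosed_iInter fun x => isClosed_iInter fun s => isClosed_iInter fun _ =>
    (isClopen_faceSum x s).1

/-- There are countably many faces, so concentration on the set means that each of countably many
clopen events is null; each of these conditions is vaguely closed. -/
theorem isClosed_exchOn_faceSumZero (r : ℕ) : IsClosed (exchOn (faceSumZero r)) := by
  have : exchOn (faceSumZero r) = exch ∩ ⋂ (x : Cube) (s : Finset ℕ) (_ : s.card = r),
      {μ | (μ : Measure Config) {g : Config | ∑ v ∈ face x s, g v = 0}ᶜ = 0} := by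
    ext μ
    simp only [exchOn, faceSumZero, Set.mem_ofPred_eq, Set.mem_inter_iff, Set.mem_iInter]
    refine and_congr_right fun _ => ?_
    simp only [ae_all_iff]
    rfl
  rw [this]
  refine isClosed_exch.inter (isClosed_iInter fun x => isClosed_iInter fun s =>
    isClosed_iInter fun _ => ?_)
  exact isClosed_eq (continuous_measure_of_isClopen (isClopen_faceSum x s).compl)
    continuous_const

/-! ### Configurations with vanishing sums over `2`-faces -/

/-- The increments of a configuration along the coordinate directions at the origin. -/
noncomputable def steps (ω : Config) : ℕ → ZMod 2 := fun i => ω (Finsupp.single i 1) - ω 0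

theorem continuous_steps : Continuous steps := by
  unfold steps; fun_prop

theorem measurable_steps : Measurable steps := continuous_steps.measurable

/-- The linear functional with coefficients `z`. -/
noncomputable def lin (z : ℕ → ZMod 2) (v : Cube) : ZMod 2 := v.sum fun i a => a * z i

theorem walkConfig_apply (w : ZMod 2 × (ℕ → ZMod 2)) (v : Cube) :
    walkConfig w v = w.1 + lin w.2 v := rfl

theorem lin_add (z : ℕ → ZMod 2) (v w : Cube) : lin z (v + w) = lin z v + lin z w :=
  Finsupp.sum_add_index' (by simp) (by simp [add_mul])

@[simp] theorem lin_zero (z : ℕ → ZMod 2) : lin z 0 = 0 := Finsupp.sum_zero_index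

@[simp] theorem lin_single (z : ℕ → ZMod 2) (i : ℕ) : lin z (Finsupp.single i 1) = z i := by
  simp [lin]

theorem lin_sum_single (z : ℕ → ZMod 2) (s : Finset ℕ) :
    lin z (∑ i ∈ s, Finsupp.single i 1) = ∑ i ∈ s, z i := by
  classical
  induction s using Finset.induction_on with
  | empty => simp
  | insert i s hi ih => rw [Finset.sum_insert hi, Finset.sum_insert hi, lin_add, ih, lin_single]

theorem lin_permuteCoords (z : ℕ → ZMod 2) (π : Equiv.Perm ℕ) (v : Cube) :
    lin z (permuteCoords π v) = lin (fun i => z (π i)) v := by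
  induction v using Finsupp.induction_linear with
  | zero => simp [permuteCoords, lin]
  | add f g hf hg =>
    rw [lin_add, ← hf, ← hg, ← lin_add]
    congr 1
    ext i
    simp [permuteCoords]
  | single i a => simp [permuteCoords, lin]

theorem shift_permuteCoords_walkConfig (π : Equiv.Perm ℕ) (w : ZMod 2 × (ℕ → ZMod 2)) :
    shift (permuteCoords π) (walkConfig w) = walkConfig (w.1, fun i => w.2 (π i)) := by
  ext1 v
  simp [shift, walkConfig_apply, lin_permuteCoords]

theorem shift_bitFlip_walkConfig (i : ℕ) (w : ZMod 2 × (ℕ → ZMod 2)) :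
    shift (bitFlip i) (walkConfig w) = walkConfig (w.1 + w.2 i, w.2) := by
  ext1 v
  simp only [shift, walkConfig_apply, bitFlip, Equiv.coe_addRight, lin_add, lin_single]
  ring

theorem walkConfig_zero (w : ZMod 2 × (ℕ → ZMod 2)) : walkConfig w 0 = w.1 := by
  simp [walkConfig_apply]

theorem steps_walkConfig (w : ZMod 2 × (ℕ → ZMod 2)) : steps (walkConfig w) = w.2 := by
  ext1 i
  simp [steps, walkConfig_apply]

theorem walkConfig_zero_right (c : ZMod 2) : walkConfig (c, 0) = fun _ => c := by
  ext1 v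
  simp [walkConfig_apply, lin]

theorem walkConfig_parallelogram (w : ZMod 2 × (ℕ → ZMod 2)) (x a b : Cube) :
    walkConfig w x + walkConfig w (x + a) + walkConfig w (x + b) + walkConfig w (x + a + b) = 0 := by
  simp only [walkConfig_apply, lin_add]
  generalize w.1 = c
  generalize lin w.2 x = X
  generalize lin w.2 a = A
  generalize lin w.2 b = B
  revert c X A B
  decide

theorem sum_face_pair (g : Config) (x : Cube) {i j : ℕ} (hij : i ≠ j) :
    ∑ v ∈ face x {i, j}, g v = g x + g (x + Finsupp.single i 1) + g (x + Finsupp.single j 1) +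
      g (x + Finsupp.single i 1 + Finsupp.single j 1) := by
  have hinj : Function.Injective
      fun a : Finset ℕ => x + ∑ i ∈ a, (Finsupp.single i 1 : Cube) := by
    intro a b h
    have h' := add_left_cancel h
    ext k
    have := DFunLike.congr_fun h' k
    simp only [Finsupp.coe_finsetSum, Finset.sum_apply, Finsupp.single_apply,
      Finset.sum_ite_eq'] at this
    by_cases ha : k ∈ a <;> by_cases hb : k ∈ b <;> simp_all
  rw [face, Finset.sum_image hinj.injOn, Finset.sum_powerset_insert (by simpa using hij),
    ← insert_empty_eq j, Finset.sum_powerset_insert (by simp),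
    Finset.sum_powerset_insert (by simp)]
  simp [hij]
  abel_nf

theorem walkConfig_mem (w : ZMod 2 × (ℕ → ZMod 2)) : walkConfig w ∈ faceSumZero 2 := by
  intro x s hs
  obtain ⟨i, j, hij, rfl⟩ := Finset.card_eq_two.1 hs
  rw [sum_face_pair _ _ hij]
  exact walkConfig_parallelogram w x _ _

theorem const_mem (c : ZMod 2) : (fun _ => c : Config) ∈ faceSumZero 2 := by
  rw [← walkConfig_zero_right]
  exact walkConfig_mem _

/-- On a `2`-face in directions `j` and `i`, the increments along its two edges in direction `i`
agree. Removing the support of `v` one direction at a time carries the increment back to the origin.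
-/
theorem add_single_of_mem {g : Config} (hg : g ∈ faceSumZero 2) (i : ℕ) (v : Cube)
    (hv : v i = 0) : g (v + Finsupp.single i 1) = g v + steps g i := by
  induction v using Finsupp.induction with
  | zero => simp [steps]
  | single_add j a f hj ha ih =>
    have ha : a = 1 := (by decide : ∀ a : ZMod 2, a ≠ 0 → a = 1) a ha
    subst ha
    have hij : j ≠ i := by
      rintro rfl
      simp [Finsupp.notMem_support_iff.1 hj] at hv
    have hf : f i = 0 := by simpa [hij] using hv
    have h := hg f {j, i} (Finset.card_pair hij)
    rw [sum_face_pair _ _ hij, ih hf, add_comm f (Finsupp.single j 1)] at h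
    revert h
    generalize g f = A
    generalize g (Finsupp.single j 1 + f) = B
    generalize g (Finsupp.single j 1 + f + Finsupp.single i 1) = C
    generalize steps g i = D
    revert A B C D
    decide

theorem walkConfig_of_mem {g : Config} (hg : g ∈ faceSumZero 2) :
    walkConfig (g 0, steps g) = g := by
  ext1 v
  induction v using Finsupp.induction with
  | zero => simp [walkConfig_apply]
  | single_add j a f hj ha ih =>
    have ha : a = 1 := (by decide : ∀ a : ZMod 2, a ≠ 0 → a = 1) a ha
    subst ha
    rw [add_comm, add_single_of_mem hg j f (Finsupp.notMem_support_iff.1 hj), ← ih]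
    simp [walkConfig_apply, lin_add, add_assoc]

theorem measurableSet_faceSumZero (r : ℕ) : MeasurableSet (faceSumZero r) :=
  (isClosed_faceSumZero r).measurableSet

/-! ### The random walk examples -/

/-- The fair coin on `𝔽₂`. -/
noncomputable abbrev coin : Measure (ZMod 2) := uniformOn Set.univ

instance isProbabilityMeasure_coin : IsProbabilityMeasure coin :=
  isProbabilityMeasure_uniformOn Set.finite_univ Set.univ_nonempty

/-- The law of independent steps that are equal to `1` with probability `p`. -/
noncomputable abbrev bernoulliSteps (p : I) : Measure (ℕ → ZMod 2) :=
  Measure.infinitePi fun _ : ℕ => bernoulliMeasure (1 : ZMod 2) 0 p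

theorem coe_randomWalk (p : I) :
    (randomWalk p : Measure Config) = (coin.prod (bernoulliSteps p)).map walkConfig := rfl

theorem coin_singleton (c : ZMod 2) : coin {c} = 2⁻¹ := by
  rw [coin, uniformOn_univ, Measure.count_singleton, ZMod.card, one_div, Nat.cast_ofNat]

theorem map_add_coin (c : ZMod 2) : coin.map (· + c) = coin := by
  refine Measure.ext_of_singleton fun a => ?_
  rw [Measure.map_apply (by fun_prop) (measurableSet_singleton _)]
  have : (· + c) ⁻¹' {a} = {a - c} := Set.ext fun _ => eq_sub_iff_add_eq.symm
  rw [this, coin_singleton, coin_singleton]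

/-- For each fixed `z` the flip adds a constant to a uniform element, so it is a measure-preserving
skew product over the identity. -/
theorem map_flip_coin_prod (ν : Measure (ℕ → ZMod 2)) [SFinite ν] (i : ℕ) :
    (coin.prod ν).map (fun w => (w.1 + w.2 i, w.2)) = coin.prod ν := by
  have h : MeasurePreserving (fun p : (ℕ → ZMod 2) × ZMod 2 => (p.1, p.2 + p.1 i))
      (ν.prod coin) (ν.prod coin) :=
    (MeasurePreserving.id ν).skew_product (g := fun z c => c + z i) (by fun_prop)
      (ae_of_all _ fun z => map_add_coin (z i))
  exact ((Measure.measurePreserving_swap (μ := ν) (ν := coin)).comp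
    (h.comp (Measure.measurePreserving_swap (μ := coin) (ν := ν)))).map_eq

theorem randomWalk_mem_exchOn (p : I) : randomWalk p ∈ exchOn (faceSumZero 2) := by
  refine ⟨fun γ hγ => map_shift_eq_of_generators (fun π => ?_) (fun i => ?_) hγ, ?_⟩
  · have hm : MeasurePreserving (fun z : ℕ → ZMod 2 => fun i => z (π i))
        (bernoulliSteps p) (bernoulliSteps p) :=
      ⟨by fun_prop, Measure.map_infinitePi_infinitePi_of_inj π.injective⟩
    have := ((MeasurePreserving.id coin).prod hm).map_eq
    rw [coe_randomWalk, Measure.map_map (measurable_shift _) measurable_walkConfig]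
    conv_rhs => rw [← this, Measure.map_map measurable_walkConfig (by fun_prop)]
    congr 1
    ext1 w
    exact shift_permuteCoords_walkConfig π w
  · rw [coe_randomWalk, Measure.map_map (measurable_shift _) measurable_walkConfig]
    conv_rhs => rw [← map_flip_coin_prod _ i, Measure.map_map measurable_walkConfig (by fun_prop)]
    congr 1
    ext1 w
    exact shift_bitFlip_walkConfig i w
  · exact (ae_map_iff measurable_walkConfig.aemeasurable
      (measurableSet_faceSumZero 2)).2 (ae_of_all _ walkConfig_mem)

theorem diracConst_mem_exchOn (c : ZMod 2) : diracConst c ∈ exchOn (faceSumZero 2) := by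
  refine ⟨fun γ _ => ?_, ?_⟩
  · change (Measure.dirac _).map _ = Measure.dirac _
    rw [Measure.map_dirac' (measurable_shift γ)]
    rfl
  · exact (ae_dirac_iff (measurableSet_faceSumZero 2)).2 (const_mem c)

theorem map_steps_randomWalk (p : I) :
    (randomWalk p : Measure Config).map steps = bernoulliSteps p := by
  rw [coe_randomWalk, Measure.map_map measurable_steps measurable_walkConfig,
    show steps ∘ walkConfig = Prod.snd from funext steps_walkConfig, Measure.map_snd_prod,
    measure_univ, one_smul]

/-- The step sequences that are equal to `1` on `s`. -/
def onesOn (s : Finset ℕ) : Set (ℕ → ZMod 2) := (s : Set ℕ).pi fun _ => {1}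

theorem mem_onesOn {s : Finset ℕ} {z : ℕ → ZMod 2} : z ∈ onesOn s ↔ ∀ i ∈ s, z i = 1 := by
  simp [onesOn]

theorem measurableSet_onesOn (s : Finset ℕ) : MeasurableSet (onesOn s) :=
  MeasurableSet.pi s.countable_toSet fun _ _ => measurableSet_singleton _

theorem bernoulliSteps_onesOn (p : I) (s : Finset ℕ) :
    bernoulliSteps p (onesOn s) = ENNReal.ofReal (p : ℝ) ^ s.card := by
  rw [onesOn, Measure.infinitePi_pi _ (by simp), Finset.prod_const,
    bernoulliMeasure_apply_of_mem_of_notMem _ (measurableSet_singleton _) (by simp) (by simp)]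
  congr 1
  exact (ENNReal.ofReal_eq_coe_nnreal p.2.1).symm

/-! ### Coupling all walks by uniform thresholds: dependence on `p` -/

/-- The steps obtained by comparing `u` to the threshold `p`. -/
noncomputable def threshold (p : I) (u : ℕ → I) : ℕ → ZMod 2 := fun i => if u i < p then 1 else 0

theorem measurable_threshold : Measurable fun q : I × (ℕ → I) => threshold q.1 q.2 := by
  refine measurable_pi_lambda _ fun i => Measurable.ite ?_ measurable_const measurable_const
  exact measurableSet_lt (by fun_prop) (by fun_prop)

/-- The probability space on which all random walk examples are constructed together. -/
noncomputable abbrev uniformSteps : Measure (ZMod 2 × (ℕ → I)) :=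
  coin.prod (Measure.infinitePi fun _ : ℕ => (volume : Measure I))

theorem measurable_walk_threshold :
    Measurable fun q : I × (ZMod 2 × (ℕ → I)) => walkConfig (q.2.1, threshold q.1 q.2.2) :=
  measurable_walkConfig.comp ((measurable_fst.comp measurable_snd).prodMk
    (measurable_threshold.comp (measurable_fst.prodMk (measurable_snd.comp measurable_snd))))

theorem map_threshold (p : I) :
    (Measure.infinitePi fun _ : ℕ => (volume : Measure I)).map (threshold p) =
      bernoulliSteps p := by
  have hm : Measurable fun x : I => if x < p then (1 : ZMod 2) else 0 :=
    Measurable.ite measurableSet_Iio measurable_const measurable_const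
  unfold threshold
  rw [Measure.infinitePi_map_pi _ (fun _ => hm)]
  congr 1
  ext1 i
  have h1 : (volume.map fun x : I => if x < p then (1 : ZMod 2) else 0) {1} =
      bernoulliMeasure (1 : ZMod 2) 0 p {1} := by
    rw [Measure.map_apply hm (measurableSet_singleton _),
      bernoulliMeasure_apply_of_mem_of_notMem _ (measurableSet_singleton _) (by simp) (by simp)]
    have : (fun x : I => if x < p then (1 : ZMod 2) else 0) ⁻¹' {1} = Set.Iio p := by
      ext x; by_cases h : x < p <;> simp [h]
    rw [this, unitInterval.volume_Iio]
    exact ENNReal.ofReal_eq_coe_nnreal p.2.1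
  have := Measure.isProbabilityMeasure_map (μ := (volume : Measure I)) hm.aemeasurable
  refine Measure.ext_of_singleton fun a => ?_
  rcases (by decide : ∀ a : ZMod 2, a = 0 ∨ a = 1) a with rfl | rfl
  · have h0 : ({0} : Set (ZMod 2)) = {1}ᶜ := by
      ext a; revert a; simp only [Set.mem_singleton_iff, Set.mem_compl_iff]; decide
    rw [h0, prob_compl_eq_one_sub (measurableSet_singleton _),
      prob_compl_eq_one_sub (measurableSet_singleton _), h1]
  · exact h1

/-- With one probability space for all `p`, the parameter enters only through the map. Measurability
in `p` then reduces to sections of a measurable set, and continuity to dominated convergence. -/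
theorem randomWalk_eq_map (p : I) :
    (randomWalk p : Measure Config) =
      uniformSteps.map fun w => walkConfig (w.1, threshold p w.2) := by
  have hm : Measurable (threshold p) :=
    measurable_threshold.comp (by fun_prop : Measurable fun u : ℕ → I => (p, u))
  have h := Measure.map_prod_map coin (Measure.infinitePi fun _ : ℕ => (volume : Measure I))
    measurable_id hm
  rw [Measure.map_id, map_threshold] at h
  rw [coe_randomWalk, h, Measure.map_map measurable_walkConfig (by fun_prop)]
  rfl

theorem measurable_randomWalk_apply {A : Set Config} (hA : MeasurableSet A) :
    Measurable fun p : I => (randomWalk p : Measure Config) A := by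
  have h : (fun p : I => (randomWalk p : Measure Config) A) = fun p => uniformSteps
      (Prod.mk p ⁻¹' ((fun q : I × (ZMod 2 × (ℕ → I)) =>
        walkConfig (q.2.1, threshold q.1 q.2.2)) ⁻¹' A)) := by
    ext1 p
    rw [randomWalk_eq_map, Measure.map_apply _ hA]
    · rfl
    · exact measurable_walk_threshold.comp measurable_prodMk_left
  rw [h]
  exact measurable_measure_prodMk_left (measurable_walk_threshold hA)

theorem continuousAt_threshold {p : I} {u : ℕ → I} (hu : ∀ i, u i ≠ p) :
    ContinuousAt (fun q => threshold q u) p := by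
  refine continuousAt_pi.2 fun i => ?_
  refine ContinuousAt.congr (f := fun _ => threshold p u i) continuousAt_const ?_
  rcases lt_or_gt_of_ne (hu i) with h | h
  · filter_upwards [lt_mem_nhds h] with q hq
    simp [threshold, h, hq]
  · filter_upwards [gt_mem_nhds h] with q hq
    simp [threshold, h.le.not_gt, hq.le.not_gt]

theorem continuous_randomWalk : Continuous randomWalk := by
  refine ProbabilityMeasure.continuous_iff_forall_continuous_integral.2 fun f => ?_
  have hcont : Continuous walkConfig := by
    unfold walkConfig Finsupp.sum; fun_prop
  have hm (p : I) : Measurable fun w : ZMod 2 × (ℕ → I) => walkConfig (w.1, threshold p w.2) :=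
    measurable_walk_threshold.comp measurable_prodMk_left
  have h : (fun p => ∫ ω, f ω ∂(randomWalk p : Measure Config)) =
      fun p => ∫ w, f (walkConfig (w.1, threshold p w.2)) ∂uniformSteps := by
    ext1 p
    rw [randomWalk_eq_map, integral_map (hm p).aemeasurable
      f.continuous.measurable.aestronglyMeasurable]
  rw [h]
  refine continuous_iff_continuousAt.2 fun p => ?_
  refine continuousAt_of_dominated (bound := fun _ => ‖f‖)
    (.of_forall fun q => (f.continuous.measurable.comp (hm q)).aestronglyMeasurable)
    (.of_forall fun q => ae_of_all _ fun w => f.norm_coe_le_norm _) (integrable_const _) ?_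
  -- The thresholded steps are discontinuous in the parameter at `p` only if some `u i` equals `p`,
  -- a null event.
  have hne : ∀ᵐ u ∂(Measure.infinitePi fun _ : ℕ => (volume : Measure I)), ∀ i, u i ≠ p := by
    refine ae_all_iff.2 fun i => ?_
    have hp : ∀ᵐ x ∂(volume : Measure I), x ≠ p := by
      simp [ae_iff]
    exact (measurePreserving_eval_infinitePi (fun _ : ℕ => (volume : Measure I))
      i).quasiMeasurePreserving.ae hp
  have hne' : ∀ᵐ w ∂uniformSteps, ∀ i, w.2 i ≠ p :=
    Measure.quasiMeasurePreserving_snd.ae hne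
  filter_upwards [hne'] with w hw
  refine f.continuous.continuousAt.comp (hcont.continuousAt.comp ?_)
  exact continuousAt_const.prodMk (continuousAt_threshold hw)

/-! ### De Finetti's theorem for sequences over `𝔽₂` -/

/-- The indicator of `1` as a real-valued function on `𝔽₂`. -/
noncomputable def oneInd (a : ZMod 2) : ℝ := if a = 1 then 1 else 0

theorem oneInd_mem (a : ZMod 2) : oneInd a ∈ I := by
  unfold oneInd; split_ifs <;> simp

theorem continuous_oneInd : Continuous oneInd := continuous_of_discreteTopology

/-- The frequency of `1` among the first `n` entries. -/
noncomputable def freq (n : ℕ) (z : ℕ → ZMod 2) : ℝ := (n : ℝ)⁻¹ * ∑ i ∈ Finset.range n, oneInd (z i)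

theorem freq_mem (n : ℕ) (z : ℕ → ZMod 2) : freq n z ∈ I := by
  have h0 : 0 ≤ ∑ i ∈ Finset.range n, oneInd (z i) := Finset.sum_nonneg fun i _ => (oneInd_mem _).1
  have h1 : ∑ i ∈ Finset.range n, oneInd (z i) ≤ n := by
    simpa using Finset.sum_le_card_nsmul (Finset.range n) (fun i => oneInd (z i)) 1
      fun i _ => (oneInd_mem _).2
  refine ⟨by unfold freq; positivity, ?_⟩
  unfold freq
  rcases n.eq_zero_or_pos with rfl | hn
  · simp
  · rw [inv_mul_le_iff₀ (by positivity)]; simpa using h1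

theorem continuous_freq (n : ℕ) : Continuous (freq n) := by
  have := continuous_oneInd
  unfold freq; fun_prop

theorem freq_swap {n a i : ℕ} (ha : a < n) (hi : i < n) (z : ℕ → ZMod 2) :
    freq n (fun k => z (Equiv.swap a i k)) = freq n z := by
  unfold freq
  congr 1
  refine Finset.sum_equiv (Equiv.swap a i) (fun k => ?_) (fun _ _ => rfl)
  simp only [Finset.mem_range]
  rcases eq_or_ne k a with rfl | hka
  · simp [ha, hi]
  rcases eq_or_ne k i with rfl | hki
  · simp [ha, hi]
  rw [Equiv.swap_apply_of_ne_of_ne hka hki]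

/-- The indicator of the step sequences equal to `1` on `s`. -/
noncomputable def prodInd (s : Finset ℕ) (z : ℕ → ZMod 2) : ℝ := ∏ i ∈ s, oneInd (z i)

theorem prodInd_mem (s : Finset ℕ) (z : ℕ → ZMod 2) : prodInd s z ∈ I :=
  ⟨Finset.prod_nonneg fun _ _ => (oneInd_mem _).1,
    Finset.prod_le_one (fun _ _ => (oneInd_mem _).1) fun _ _ => (oneInd_mem _).2⟩

theorem continuous_prodInd (s : Finset ℕ) : Continuous (prodInd s) := by
  have := continuous_oneInd
  unfold prodInd; fun_prop

theorem prodInd_eq_indicator (s : Finset ℕ) : prodInd s = (onesOn s).indicator 1 := by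
  ext1 z
  by_cases h : z ∈ onesOn s
  · rw [Set.indicator_of_mem h]
    exact Finset.prod_eq_one fun i hi => by simp [oneInd, mem_onesOn.1 h i hi]
  · rw [Set.indicator_of_notMem h]
    simp only [mem_onesOn, not_forall] at h
    obtain ⟨i, hi, hz⟩ := h
    exact Finset.prod_eq_zero hi (by simp [oneInd, hz])

theorem integral_prodInd (θ : Measure (ℕ → ZMod 2)) (s : Finset ℕ) :
    ∫ z, prodInd s z ∂θ = θ.real (onesOn s) := by
  rw [prodInd_eq_indicator, integral_indicator_one (measurableSet_onesOn s)]

theorem integrable_of_continuous_of_mem {θ : Measure (ℕ → ZMod 2)} [IsProbabilityMeasure θ]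
    {f : (ℕ → ZMod 2) → ℝ} (hf : Continuous f)
    (h : ∀ z, f z ∈ I) : Integrable f θ :=
  Integrable.of_bound hf.measurable.aestronglyMeasurable 1
    (ae_of_all _ fun z => by rw [Real.norm_eq_abs, abs_of_nonneg (h z).1]; exact (h z).2)

theorem abs_integral_sub_le_one {θ : Measure (ℕ → ZMod 2)} [IsProbabilityMeasure θ]
    {f g : (ℕ → ZMod 2) → ℝ} (hf : ∀ z, f z ∈ I) (hg : ∀ z, g z ∈ I)
    (hfc : Continuous f) (hgc : Continuous g) : |∫ z, f z ∂θ - ∫ z, g z ∂θ| ≤ 1 := by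
  rw [← integral_sub (integrable_of_continuous_of_mem hfc hf)
    (integrable_of_continuous_of_mem hgc hg)]
  rw [← Real.norm_eq_abs]
  refine (norm_integral_le_of_norm_le_const (μ := θ) (C := 1) (ae_of_all _ fun z => ?_)).trans
    (by simp)
  rw [Real.norm_eq_abs, abs_le]
  constructor <;> linarith [(hf z).1, (hf z).2, (hg z).1, (hg z).2]

theorem integral_swap {θ : Measure (ℕ → ZMod 2)}
    (hθ : ∀ i j, θ.map (fun z k => z (Equiv.swap i j k)) = θ)
    {f : (ℕ → ZMod 2) → ℝ} (hf : Continuous f) (i j : ℕ) :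
    ∫ z, f (fun k => z (Equiv.swap i j k)) ∂θ = ∫ z, f z ∂θ := by
  have hm : Measurable fun (z : ℕ → ZMod 2) k => z (Equiv.swap i j k) :=
    measurable_pi_lambda _ fun _ => measurable_pi_apply _
  conv_rhs => rw [← hθ i j]
  rw [integral_map hm.aemeasurable hf.measurable.aestronglyMeasurable]

/-- By exchangeability the factor `oneInd (z a)` can be replaced by `oneInd (z i)` for every `i < n`
outside `s`, hence by its average `freq n`, up to the indices in `s`. -/
theorem abs_integral_prodInd_insert_sub_le {θ : Measure (ℕ → ZMod 2)} [IsProbabilityMeasure θ]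
    (hθ : ∀ i j, θ.map (fun z k => z (Equiv.swap i j k)) = θ)
    {n a : ℕ} {s : Finset ℕ} (ha : a < n) (has : a ∉ s) (j : ℕ) :
    |∫ z, prodInd (insert a s) z * freq n z ^ j ∂θ - ∫ z, prodInd s z * freq n z ^ (j + 1) ∂θ| ≤
      s.card / n := by
  have hn : (0 : ℝ) < n := by exact_mod_cast (Nat.zero_le a).trans_lt ha
  have hc1 := continuous_freq n
  have hc2 := continuous_prodInd s
  have hc3 := continuous_oneInd
  set F : ℕ → (ℕ → ZMod 2) → ℝ := fun i z => oneInd (z i) * prodInd s z * freq n z ^ j with hF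
  have hFc (i : ℕ) : Continuous (F i) := by fun_prop
  have hFm (i : ℕ) (z : ℕ → ZMod 2) : F i z ∈ I :=
    unitInterval.mul_mem (unitInterval.mul_mem (oneInd_mem _) (prodInd_mem s z))
      (pow_mem (S := unitInterval.submonoid) (freq_mem n z) j)
  have h1 : ∫ z, prodInd (insert a s) z * freq n z ^ j ∂θ = ∫ z, F a z ∂θ := by
    simp only [prodInd, Finset.prod_insert has, hF]
  have h2 : ∫ z, prodInd s z * freq n z ^ (j + 1) ∂θ =
      (n : ℝ)⁻¹ * ∑ i ∈ Finset.range n, ∫ z, F i z ∂θ := by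
    rw [← integral_finsetSum _ fun i _ => integrable_of_continuous_of_mem (hFc i) (hFm i),
      ← integral_const_mul]
    congr 1
    ext1 z
    simp only [hF]
    rw [← Finset.sum_mul, ← Finset.sum_mul, pow_succ]
    nth_rewrite 2 [freq]
    ring
  -- An index in `s` costs at most `1`. For any other, the transposition of `a` and `i` fixes both
  -- `prodInd s` and `freq n`, and the integrals agree.
  have h3 (i : ℕ) (hi : i ∈ Finset.range n) :
      |∫ z, F a z ∂θ - ∫ z, F i z ∂θ| ≤ if i ∈ s then 1 else 0 := by
    split_ifs with his
    · exact abs_integral_sub_le_one (hFm a) (hFm i) (hFc a) (hFc i)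
    · rw [← integral_swap hθ (hFc i) a i]
      have : (fun z : ℕ → ZMod 2 => F i fun k => z (Equiv.swap a i k)) = F a := by
        ext1 z
        simp only [hF, Equiv.swap_apply_right, freq_swap ha (Finset.mem_range.1 hi)]
        congr 2
        refine Finset.prod_congr rfl fun k hk => ?_
        simp only
        rw [Equiv.swap_apply_of_ne_of_ne]
        · rintro rfl; exact has hk
        · rintro rfl; exact his hk
      rw [this, sub_self, abs_zero]
  have h4 : ∫ z, F a z ∂θ - (n : ℝ)⁻¹ * ∑ i ∈ Finset.range n, ∫ z, F i z ∂θ =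
      (n : ℝ)⁻¹ * ∑ i ∈ Finset.range n, (∫ z, F a z ∂θ - ∫ z, F i z ∂θ) := by
    rw [Finset.sum_sub_distrib, Finset.sum_const, Finset.card_range, nsmul_eq_mul]
    field_simp
  rw [h1, h2, h4, abs_mul, abs_of_pos (inv_pos.2 hn), div_eq_inv_mul]
  refine mul_le_mul_of_nonneg_left ?_ (inv_pos.2 hn).le
  refine (Finset.abs_sum_le_sum_abs _ _).trans ((Finset.sum_le_sum h3).trans ?_)
  rw [← Finset.sum_filter, Finset.sum_const, nsmul_eq_mul, mul_one]
  exact_mod_cast Finset.card_le_card fun i hi => (Finset.mem_filter.1 hi).2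

/-- Trading the factors for frequencies one at a time costs `0 + 1 + ⋯ + (s.card - 1)` over `n`,
which the square bounds. -/
theorem abs_integral_prodInd_sub_le {θ : Measure (ℕ → ZMod 2)} [IsProbabilityMeasure θ]
    (hθ : ∀ i j, θ.map (fun z k => z (Equiv.swap i j k)) = θ) {n : ℕ} (s : Finset ℕ)
    (hs : ∀ i ∈ s, i < n) (j : ℕ) :
    |∫ z, prodInd s z * freq n z ^ j ∂θ - ∫ z, freq n z ^ (s.card + j) ∂θ| ≤
      (s.card : ℝ) ^ 2 / n := by
  induction s using Finset.induction_on generalizing j with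
  | empty => simp [prodInd]
  | insert a s ha ih =>
    have h1 := abs_integral_prodInd_insert_sub_le hθ (hs a (by simp)) ha j
    have h2 := ih (fun i hi => hs i (by simp [hi])) (j + 1)
    rw [Finset.card_insert_of_notMem ha, show s.card + 1 + j = s.card + (j + 1) by ring]
    refine (abs_sub_le _ _ _).trans ((add_le_add h1 h2).trans ?_)
    rw [← add_div]
    gcongr
    push_cast
    nlinarith [(Nat.cast_nonneg s.card : (0 : ℝ) ≤ s.card)]

/-- The mixing measure is a limit point of the laws of the empirical frequencies. Their moments
converge to the probabilities of the events `onesOn s`. -/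
theorem exists_moments_eq {θ : Measure (ℕ → ZMod 2)} [IsProbabilityMeasure θ]
    (hθ : ∀ i j, θ.map (fun z k => z (Equiv.swap i j k)) = θ) :
    ∃ m : ProbabilityMeasure I, ∀ s : Finset ℕ,
      θ.real (onesOn s) = ∫ q, (q : ℝ) ^ s.card ∂(m : Measure I) := by
  have hmeas (n : ℕ) : Measurable fun z => (⟨freq n z, freq_mem n z⟩ : I) :=
    (continuous_freq n).measurable.subtype_mk
  set m : ℕ → ProbabilityMeasure I := fun n =>
    ⟨θ.map fun z => ⟨freq n z, freq_mem n z⟩,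
      Measure.isProbabilityMeasure_map (hmeas n).aemeasurable⟩ with hm
  -- Probability measures on the unit interval form a compact space; an ultrafilter limit avoids
  -- choosing a subsequence.
  obtain ⟨M, -, hM⟩ := isCompact_univ.ultrafilter_le_nhds ((hyperfilter ℕ).map m) (by simp)
  have hM' : Tendsto m (hyperfilter ℕ) (𝓝 M) := hM
  refine ⟨M, fun s => ?_⟩
  have hpow : Continuous fun q : I => (q : ℝ) ^ s.card := by fun_prop
  have h1 := (ProbabilityMeasure.continuous_integral_continuousMap
    (⟨_, hpow⟩ : C(I, ℝ))).continuousAt.tendsto.comp hM'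
  have h2 (n : ℕ) : ∫ q, (q : ℝ) ^ s.card ∂(m n : Measure I) = ∫ z, freq n z ^ s.card ∂θ := by
    change ∫ q : I, (q : ℝ) ^ s.card ∂(θ.map _) = _
    rw [integral_map (hmeas n).aemeasurable hpow.measurable.aestronglyMeasurable]
  have h3 : Tendsto (fun n => ∫ z, freq n z ^ s.card ∂θ) atTop (𝓝 (θ.real (onesOn s))) := by
    rw [← integral_prodInd, tendsto_iff_dist_tendsto_zero]
    refine squeeze_zero' (.of_forall fun _ => dist_nonneg) ?_
      (tendsto_const_div_atTop_nhds_zero_nat ((s.card : ℝ) ^ 2))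
    obtain ⟨N, hN⟩ := s.bddAbove
    filter_upwards [eventually_gt_atTop N] with n hn
    have := abs_integral_prodInd_sub_le hθ s (fun i hi => (hN hi).trans_lt hn) 0
    simpa [Real.dist_eq, abs_sub_comm] using this
  refine tendsto_nhds_unique (h3.mono_left Nat.hyperfilter_le_atTop) ?_
  simpa only [Function.comp_def, ContinuousMap.coe_mk, h2] using h1

theorem generateFrom_onesOn :
    (inferInstance : MeasurableSpace (ℕ → ZMod 2)) =
      MeasurableSpace.generateFrom (Set.range onesOn) := by
  refine le_antisymm ?_ (MeasurableSpace.generateFrom_le ?_)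
  · refine iSup_le fun i => ?_
    rintro _ ⟨t, -, rfl⟩
    have h1 : MeasurableSet[MeasurableSpace.generateFrom (Set.range onesOn)]
        {z : ℕ → ZMod 2 | z i = 1} := by
      refine MeasurableSpace.measurableSet_generateFrom ⟨{i}, ?_⟩
      ext; simp [mem_onesOn]
    have key : ((fun z : ℕ → ZMod 2 => z i) ⁻¹' t) =
        ({z | z i = 1} ∩ {_z | (1 : ZMod 2) ∈ t}) ∪ ({z | z i = 1}ᶜ ∩ {_z | (0 : ZMod 2) ∈ t}) := by
      ext z
      rcases (by decide : ∀ a : ZMod 2, a = 0 ∨ a = 1) (z i) with h | h <;> simp [h]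
    change MeasurableSet[MeasurableSpace.generateFrom (Set.range onesOn)]
      ((fun z : ℕ → ZMod 2 => z i) ⁻¹' t)
    rw [key]
    exact (h1.inter (@MeasurableSet.const _ (_) _)).union
      (h1.compl.inter (@MeasurableSet.const _ (_) _))
  · rintro _ ⟨s, rfl⟩
    exact measurableSet_onesOn s

theorem isPiSystem_range_onesOn : IsPiSystem (Set.range onesOn) := by
  rintro _ ⟨s, rfl⟩ _ ⟨t, rfl⟩ -
  refine ⟨s ∪ t, ?_⟩
  ext z
  simp only [mem_onesOn, Finset.mem_union, Set.mem_inter_iff]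
  exact ⟨fun h => ⟨fun i hi => h i (.inl hi), fun i hi => h i (.inr hi)⟩,
    fun h i hi => hi.elim (h.1 i) (h.2 i)⟩

theorem bernoulliSteps_apply (p : I) {A : Set (ℕ → ZMod 2)} (hA : MeasurableSet A) :
    bernoulliSteps p A = (randomWalk p : Measure Config) (steps ⁻¹' A) := by
  rw [← map_steps_randomWalk, Measure.map_apply measurable_steps hA]

theorem measurable_bernoulliSteps : Measurable fun p : I => bernoulliSteps p := by
  refine Measure.measurable_of_measurable_coe _ fun A hA => ?_
  simp only [bernoulliSteps_apply _ hA]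
  exact measurable_randomWalk_apply (measurable_steps hA)

theorem measurable_randomWalk : Measurable fun p : I => (randomWalk p : Measure Config) :=
  Measure.measurable_of_measurable_coe _ fun _ hA => measurable_randomWalk_apply hA

/-- **De Finetti's theorem** for exchangeable sequences over `𝔽₂`. -/
theorem exists_eq_bind_bernoulliSteps {θ : Measure (ℕ → ZMod 2)} [IsProbabilityMeasure θ]
    (hθ : ∀ i j, θ.map (fun z k => z (Equiv.swap i j k)) = θ) :
    ∃ m : ProbabilityMeasure I, θ = (m : Measure I).bind bernoulliSteps := by
  obtain ⟨m, hm⟩ := exists_moments_eq hθ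
  refine ⟨m, ?_⟩
  have key (s : Finset ℕ) : θ (onesOn s) = (m : Measure I).bind bernoulliSteps (onesOn s) := by
    rw [Measure.bind_apply (measurableSet_onesOn s) measurable_bernoulliSteps.aemeasurable]
    simp only [bernoulliSteps_onesOn]
    rw [← ofReal_measureReal, hm, ofReal_integral_eq_lintegral_ofReal]
    · refine lintegral_congr fun q => ?_
      rw [ENNReal.ofReal_pow q.2.1]
    · refine Integrable.of_bound (by fun_prop) 1 (ae_of_all _ fun q => ?_)
      rw [Real.norm_eq_abs, abs_of_nonneg (pow_nonneg q.2.1 _)]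
      exact pow_le_one₀ q.2.1 q.2.2
    · exact ae_of_all _ fun q => pow_nonneg q.2.1 _
  refine ext_of_generate_finite _ generateFrom_onesOn isPiSystem_range_onesOn ?_ ?_
  · rintro _ ⟨s, rfl⟩
    exact key s
  -- The empty cylinder gives equality of the total masses.
  · have : onesOn ∅ = Set.univ := by ext; simp [mem_onesOn]
    rw [← this, key]

/-! ### The exchangeable measures on configurations with vanishing face sums -/

/-- The mixture of the two constant configurations and of the random walk examples. -/
noncomputable def mixture (a b : ℝ≥0∞) (m : Measure I) : Measure Config :=
  a • (diracConst 0 : Measure Config) + b • (diracConst 1 : Measure Config) +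
    m.bind fun p => (randomWalk p : Measure Config)

theorem mixture_apply (a b : ℝ≥0∞) (m : Measure I) {A : Set Config} (hA : MeasurableSet A) :
    mixture a b m A = a * (diracConst 0 : Measure Config) A +
      b * (diracConst 1 : Measure Config) A + ∫⁻ p, (randomWalk p : Measure Config) A ∂m := by
  rw [mixture, Measure.add_apply, Measure.add_apply, Measure.smul_apply, Measure.smul_apply,
    Measure.bind_apply hA measurable_randomWalk.aemeasurable, smul_eq_mul, smul_eq_mul]

theorem mixture_univ (a b : ℝ≥0∞) (m : Measure I) :
    mixture a b m Set.univ = a + b + m Set.univ := by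
  simp [mixture_apply]

theorem mem_exchOn_of_eq_mixture {μ : ProbabilityMeasure Config} {a b : ℝ≥0∞} {m : Measure I}
    (h : (μ : Measure Config) = mixture a b m) : μ ∈ exchOn (faceSumZero 2) := by
  refine ⟨fun γ hγ => ?_, ?_⟩
  · ext A hA
    rw [Measure.map_apply (measurable_shift γ) hA, h, mixture_apply _ _ _ hA,
      mixture_apply _ _ _ (measurable_shift γ hA),
      measure_preimage_shift (diracConst_mem_exchOn 0).1 hγ hA,
      measure_preimage_shift (diracConst_mem_exchOn 1).1 hγ hA]
    simp only [measure_preimage_shift (randomWalk_mem_exchOn _).1 hγ hA]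
  · change (μ : Measure Config) (faceSumZero 2)ᶜ = 0
    have h0 : (diracConst 0 : Measure Config) (faceSumZero 2)ᶜ = 0 := (diracConst_mem_exchOn 0).2
    have h1 : (diracConst 1 : Measure Config) (faceSumZero 2)ᶜ = 0 := (diracConst_mem_exchOn 1).2
    have h2 (p : I) : (randomWalk p : Measure Config) (faceSumZero 2)ᶜ = 0 :=
      (randomWalk_mem_exchOn p).2
    rw [h, mixture_apply _ _ _ (measurableSet_faceSumZero 2).compl]
    simp [h0, h1, h2]

/-- The value at the origin and the steps of a configuration. -/
noncomputable def walkCoords (ω : Config) : ZMod 2 × (ℕ → ZMod 2) := (ω 0, steps ω)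

theorem measurable_walkCoords : Measurable walkCoords :=
  (measurable_pi_apply 0).prodMk measurable_steps

theorem walkCoords_walkConfig (w : ZMod 2 × (ℕ → ZMod 2)) : walkCoords (walkConfig w) = w :=
  Prod.ext (walkConfig_zero w) (steps_walkConfig w)

theorem steps_shift_permuteCoords (π : Equiv.Perm ℕ) (ω : Config) :
    steps (shift (permuteCoords π) ω) = fun k => steps ω (π k) := by
  ext1 k
  simp [steps, shift, permuteCoords]

theorem map_walkConfig_map_walkCoords {μ : ProbabilityMeasure Config}
    (hμ : μ ∈ exchOn (faceSumZero 2)) :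
    ((μ : Measure Config).map walkCoords).map walkConfig = μ := by
  rw [Measure.map_map measurable_walkConfig measurable_walkCoords]
  conv_rhs => rw [← Measure.map_id (μ := (μ : Measure Config))]
  refine Measure.map_congr ?_
  filter_upwards [hμ.2] with ω hω
  exact walkConfig_of_mem hω

theorem map_steps_swap {μ : ProbabilityMeasure Config} (hμ : μ ∈ exch) (i j : ℕ) :
    ((μ : Measure Config).map steps).map (fun z k => z (Equiv.swap i j k)) =
      (μ : Measure Config).map steps := by
  have hm : Measurable fun (z : ℕ → ZMod 2) k => z (Equiv.swap i j k) :=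
    measurable_pi_lambda _ fun _ => measurable_pi_apply _
  conv_rhs => rw [← hμ _ (swap_mem_cubeIsom i j), Measure.map_map measurable_steps
    (measurable_shift _)]
  rw [Measure.map_map hm measurable_steps]
  congr 1
  ext1 ω
  exact (steps_shift_permuteCoords _ ω).symm

/-- A flip leaves the steps unchanged only for affine configurations, so the intertwining of the two
actions holds almost everywhere. -/
theorem map_walkCoords_flip {μ : ProbabilityMeasure Config} (hμ : μ ∈ exchOn (faceSumZero 2))
    (i : ℕ) :
    ((μ : Measure Config).map walkCoords).map (fun w => (w.1 + w.2 i, w.2)) =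
      (μ : Measure Config).map walkCoords := by
  conv_rhs => rw [← hμ.1 _ (bitFlip_mem_cubeIsom i), Measure.map_map measurable_walkCoords
    (measurable_shift _)]
  rw [Measure.map_map (by fun_prop) measurable_walkCoords]
  refine Measure.map_congr ?_
  filter_upwards [hμ.2] with ω hω
  have := shift_bitFlip_walkConfig i (walkCoords ω)
  rw [walkCoords, walkConfig_of_mem hω] at this
  simp only [Function.comp_apply]
  rw [this, walkCoords_walkConfig]
  rfl

/-- The flip exchanges the slices `{0} ×ˢ t` and `{1} ×ˢ t`, so each carries half of the mass over
`t`. -/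
theorem eq_coin_prod_of_flip {κ : Measure (ZMod 2 × (ℕ → ZMod 2))} [IsFiniteMeasure κ]
    (h : κ.map (fun w => (w.1 + 1, w.2)) = κ) : κ = coin.prod κ.snd := by
  refine (Measure.prod_eq fun s t hs ht => ?_).symm
  have hsing (c : ZMod 2) : κ ({c} ×ˢ t) = 2⁻¹ * κ.snd t := by
    have h0 : κ ({(0 : ZMod 2)} ×ˢ t) = κ ({(1 : ZMod 2)} ×ˢ t) := by
      conv_rhs => rw [← h, Measure.map_apply (by fun_prop) ((measurableSet_singleton _).prod ht)]
      congr 1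
      ext ⟨a, z⟩
      simp
    have h1 : κ.snd t = κ ({(0 : ZMod 2)} ×ˢ t) + κ ({(1 : ZMod 2)} ×ˢ t) := by
      rw [Measure.snd_apply ht, ← measure_union _ ((measurableSet_singleton _).prod ht)]
      · congr 1
        ext ⟨a, z⟩
        rcases (by decide : ∀ a : ZMod 2, a = 0 ∨ a = 1) a with rfl | rfl <;> simp
      · rw [Set.disjoint_left]
        rintro ⟨a, z⟩ ⟨ha, -⟩ ⟨hb, -⟩
        simp_all
    have h2 (x : ℝ≥0∞) : 2⁻¹ * (x + x) = x := by
      rw [← two_mul, ← mul_assoc, ENNReal.inv_mul_cancel (by simp) (by simp), one_mul]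
    rcases (by decide : ∀ a : ZMod 2, a = 0 ∨ a = 1) c with rfl | rfl
    · rw [h1, ← h0, h2]
    · rw [h1, h0, h2]
  have hmeas : ((κ.restrict (Set.univ ×ˢ t)).map Prod.fst) = κ.snd t • coin := by
    refine Measure.ext_of_singleton fun c => ?_
    rw [Measure.map_apply measurable_fst (measurableSet_singleton _),
      Measure.restrict_apply (measurable_fst (measurableSet_singleton _)),
      Measure.smul_apply, coin_singleton, smul_eq_mul, mul_comm, ← hsing c]
    congr 1
    ext; simp
  have := congrArg (fun ρ => ρ s) hmeas
  simp only [Measure.map_apply measurable_fst hs, Measure.restrict_apply (measurable_fst hs),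
    Measure.smul_apply, smul_eq_mul] at this
  rw [mul_comm, ← this]
  congr 1
  ext; simp

/-- If the flips preserve `κ`, then on nonzero steps the starting point is a fair coin that is
independent of the steps. -/
theorem restrict_eq_coin_prod_restrict {κ : Measure (ZMod 2 × (ℕ → ZMod 2))} [IsFiniteMeasure κ]
    (h : ∀ i, κ.map (fun w => (w.1 + w.2 i, w.2)) = κ) :
    κ.restrict {w | w.2 ≠ 0} = (coin.prod κ.snd).restrict {w | w.2 ≠ 0} := by
  have hU : {w : ZMod 2 × (ℕ → ZMod 2) | w.2 ≠ 0} = ⋃ i, {w | w.2 i = 1} := by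
    ext w
    simp only [Set.mem_ofPred_eq, Set.mem_iUnion, Function.ne_iff, Pi.zero_apply]
    exact exists_congr fun i => (by decide : ∀ a : ZMod 2, a ≠ 0 ↔ a = 1) _
  -- It suffices to compare on each event `z_i = 1`. There the `i`-th flip always changes the
  -- starting point, and it preserves the event because it does not move the steps.
  rw [hU, Measure.restrict_iUnion_congr]
  intro i
  set E : Set (ZMod 2 × (ℕ → ZMod 2)) := {w | w.2 i = 1} with hE
  have hEm' : MeasurableSet {z : ℕ → ZMod 2 | z i = 1} :=
    measurable_pi_apply i (measurableSet_singleton 1)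
  have hEm : MeasurableSet E := measurable_snd hEm'
  have hflip : (κ.restrict E).map (fun w => (w.1 + 1, w.2)) = κ.restrict E := by
    have h1 : (κ.restrict E).map (fun w => (w.1 + 1, w.2)) =
        (κ.restrict E).map (fun w => (w.1 + w.2 i, w.2)) := by
      refine Measure.map_congr ?_
      filter_upwards [ae_restrict_mem hEm] with w hw
      rw [show w.2 i = 1 from hw]
    have h2 : E = (fun w : ZMod 2 × (ℕ → ZMod 2) => (w.1 + w.2 i, w.2)) ⁻¹' E := rfl
    rw [h1]
    conv_lhs => rw [h2, ← Measure.restrict_map (by fun_prop) hEm, h i]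
  have hsnd : (κ.restrict E).snd = κ.snd.restrict {z | z i = 1} := by
    rw [Measure.snd, Measure.snd, Measure.restrict_map measurable_snd hEm']
    rfl
  rw [eq_coin_prod_of_flip hflip, hsnd]
  conv_lhs => rw [← Measure.restrict_univ (μ := coin), Measure.prod_restrict]
  congr 1
  ext; simp [hE]

theorem coin_prod_bernoulliSteps (p : I) :
    coin.prod (bernoulliSteps p) = (randomWalk p : Measure Config).map walkCoords := by
  rw [coe_randomWalk, Measure.map_map measurable_walkCoords measurable_walkConfig,
    show walkCoords ∘ walkConfig = id from funext walkCoords_walkConfig, Measure.map_id]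

theorem measurable_coin_prod_bernoulliSteps :
    Measurable fun p : I => coin.prod (bernoulliSteps p) := by
  simp only [coin_prod_bernoulliSteps]
  exact (Measure.measurable_map _ measurable_walkCoords).comp measurable_randomWalk

theorem coin_prod_bind (m : ProbabilityMeasure I) :
    coin.prod ((m : Measure I).bind bernoulliSteps) =
      (m : Measure I).bind fun p => coin.prod (bernoulliSteps p) := by
  have : IsProbabilityMeasure ((m : Measure I).bind bernoulliSteps) :=
    isProbabilityMeasure_bind measurable_bernoulliSteps.aemeasurable
      (ae_of_all _ fun p => inferInstance)
  refine Measure.prod_eq fun s t hs ht => ?_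
  rw [Measure.bind_apply (hs.prod ht) measurable_coin_prod_bernoulliSteps.aemeasurable,
    Measure.bind_apply ht measurable_bernoulliSteps.aemeasurable]
  simp only [Measure.prod_prod]
  exact lintegral_const_mul _ ((Measure.measurable_coe ht).comp measurable_bernoulliSteps)

/-- The first `n` steps vanish with probability `(1 - p) ^ n`, which tends to `0`. -/
theorem bernoulliSteps_singleton_zero {p : I} (hp : 0 < p) : bernoulliSteps p {0} = 0 := by
  have hlt : ENNReal.ofReal (1 - p) < 1 := by
    rw [ENNReal.ofReal_lt_one]
    have : (0 : ℝ) < p := hp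
    linarith
  refine le_antisymm (ge_of_tendsto' (ENNReal.tendsto_pow_atTop_nhds_zero_of_lt_one hlt)
    fun n => ?_) zero_le
  have hle : ({0} : Set (ℕ → ZMod 2)) ⊆ (Finset.range n : Set ℕ).pi fun _ => {0} := by
    rintro _ rfl i -
    rfl
  refine (measure_mono hle).trans (le_of_eq ?_)
  rw [Measure.infinitePi_pi _ (by simp), Finset.prod_const, Finset.card_range,
    bernoulliMeasure_apply_of_notMem_of_mem _ (measurableSet_singleton _) (by simp) (by simp)]
  congr 1
  exact (ENNReal.ofReal_eq_coe_nnreal (by linarith [p.2.2] : (0 : ℝ) ≤ 1 - p)).symm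

theorem bernoulliSteps_zero : bernoulliSteps 0 = Measure.dirac 0 := by
  simp [bernoulliSteps]
  rfl

theorem exists_eq_mixture {μ : ProbabilityMeasure Config} (hμ : μ ∈ exchOn (faceSumZero 2)) :
    ∃ (a b : ℝ≥0∞) (m : Measure I), a + b + m Set.univ = 1 ∧
      (μ : Measure Config) = mixture a b m := by
  have := Measure.isProbabilityMeasure_map (μ := (μ : Measure Config))
    measurable_steps.aemeasurable
  have := Measure.isProbabilityMeasure_map (μ := (μ : Measure Config))
    measurable_walkCoords.aemeasurable
  obtain ⟨m, hm⟩ := exists_eq_bind_bernoulliSteps (map_steps_swap hμ.1)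
  set κ := (μ : Measure Config).map walkCoords with hκ
  have hsnd : κ.snd = (m : Measure I).bind bernoulliSteps := by
    rw [← hm, hκ, Measure.snd, Measure.map_map measurable_snd measurable_walkCoords]
    rfl
  have hN : MeasurableSet {w : ZMod 2 × (ℕ → ZMod 2) | w.2 ≠ 0} :=
    measurable_snd (measurableSet_singleton 0).compl
  have hres := restrict_eq_coin_prod_restrict (map_walkCoords_flip hμ)
  rw [← hκ, hsnd, coin_prod_bind] at hres
  -- The part with zero steps supplies the two atoms. De Finetti's measure is cut down to `p > 0`
  -- because the Bernoulli law at `0` lives on zero steps, which the atoms already count.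
  have hmain : (μ : Measure Config) =
      mixture (κ {(0, 0)}) (κ {(1, 0)}) ((m : Measure I).restrict (Set.Ioi 0)) := by
    ext A hA
    have hW := measurable_walkConfig hA
    conv_lhs => rw [← map_walkConfig_map_walkCoords hμ]
    rw [Measure.map_apply measurable_walkConfig hA, mixture_apply _ _ _ hA,
      ← measure_inter_add_sdiff _ hN, add_comm]
    congr 1
    · have h1 : (walkConfig ⁻¹' A) \ {w | w.2 ≠ 0} =
          ((walkConfig ⁻¹' A) ∩ {(0, 0)}) ∪ ((walkConfig ⁻¹' A) ∩ {(1, 0)}) := by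
        ext ⟨c, z⟩
        rcases (by decide : ∀ a : ZMod 2, a = 0 ∨ a = 1) c with rfl | rfl <;> simp
      have h2 (c : ZMod 2) : κ ((walkConfig ⁻¹' A) ∩ {(c, 0)}) =
          κ {(c, 0)} * (diracConst c : Measure Config) A := by
        change _ = _ * (Measure.dirac (fun _ : Cube => c)) A
        rw [Measure.dirac_apply' _ hA]
        by_cases h : (fun _ : Cube => c) ∈ A
        · rw [Set.inter_eq_right.2, Set.indicator_of_mem h, Pi.one_apply, mul_one]
          rintro _ rfl
          rwa [Set.mem_preimage, walkConfig_zero_right]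
        · rw [Set.indicator_of_notMem h, mul_zero, Set.inter_singleton_eq_empty.2, measure_empty]
          rwa [Set.mem_preimage, walkConfig_zero_right]
      rw [h1, measure_union _ (hW.inter (measurableSet_singleton _)), h2, h2]
      rw [Set.disjoint_left]
      rintro _ ⟨-, rfl⟩ ⟨-, h⟩
      simp at h
    · rw [← hκ, ← Measure.restrict_apply hW, hres, Measure.restrict_apply hW,
        Measure.bind_apply (hW.inter hN) measurable_coin_prod_bernoulliSteps.aemeasurable,
        ← lintegral_indicator measurableSet_Ioi]
      refine lintegral_congr fun p => ?_
      rcases eq_or_lt_of_le p.2.1 with hp | hp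
      · have hp : p = 0 := Subtype.ext hp.symm
        subst hp
        rw [Set.indicator_of_notMem (by simp), bernoulliSteps_zero]
        refine measure_mono_null Set.inter_subset_right ?_
        rw [show {w : ZMod 2 × (ℕ → ZMod 2) | w.2 ≠ 0} = Set.univ ×ˢ {0}ᶜ by ext; simp,
          Measure.prod_prod]
        simp
      · rw [Set.indicator_of_mem (show p ∈ Set.Ioi 0 from hp), coe_randomWalk,
          Measure.map_apply measurable_walkConfig hA]
        refine measure_inter_conull ?_
        rw [show {w : ZMod 2 × (ℕ → ZMod 2) | w.2 ≠ 0}ᶜ = Set.univ ×ˢ {0} by ext; simp,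
          Measure.prod_prod, bernoulliSteps_singleton_zero hp, mul_zero]
  refine ⟨_, _, _, ?_, hmain⟩
  rw [← mixture_univ, ← hmain, measure_univ]

theorem mem_exchOn_iff_mixture (μ : ProbabilityMeasure Config) :
    μ ∈ exchOn (faceSumZero 2) ↔
      ∃ (a b : ℝ≥0∞) (m : Measure I), a + b + m Set.univ = 1 ∧
        (μ : Measure Config) = mixture a b m :=
  ⟨exists_eq_mixture, fun ⟨_, _, _, _, h⟩ => mem_exchOn_of_eq_mixture h⟩

/-! ### Extreme points and ergodicity -/

theorem randomWalk_zero : randomWalk 0 = halfHalf := by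
  have hcoin : coin = (2⁻¹ : ℝ≥0∞) • Measure.dirac 0 + (2⁻¹ : ℝ≥0∞) • Measure.dirac 1 := by
    refine Measure.ext_of_singleton fun c => ?_
    rw [coin_singleton]
    rcases (by decide : ∀ a : ZMod 2, a = 0 ∨ a = 1) c with rfl | rfl <;> simp
  refine ProbabilityMeasure.toMeasure_injective ?_
  have hm : Measurable fun c : ZMod 2 => walkConfig (c, 0) := measurable_from_top
  rw [coe_randomWalk, bernoulliSteps_zero, Measure.prod_dirac,
    Measure.map_map measurable_walkConfig (by fun_prop)]
  change coin.map (fun c => walkConfig (c, 0)) = _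
  rw [hcoin, Measure.map_add _ _ hm, Measure.map_smul, Measure.map_smul, Measure.map_dirac' hm,
    Measure.map_dirac' hm, walkConfig_zero_right, walkConfig_zero_right]
  rfl

/-- The event that the steps in the directions of `s` are equal to `1`. -/
def stepsOnes (s : Finset ℕ) : Set Config := steps ⁻¹' onesOn s

theorem measurableSet_stepsOnes (s : Finset ℕ) : MeasurableSet (stepsOnes s) :=
  measurable_steps (measurableSet_onesOn s)

theorem randomWalk_stepsOnes (p : I) (s : Finset ℕ) :
    (randomWalk p : Measure Config) (stepsOnes s) = ENNReal.ofReal (p : ℝ) ^ s.card := by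
  rw [stepsOnes, ← Measure.map_apply measurable_steps (measurableSet_onesOn s),
    map_steps_randomWalk, bernoulliSteps_onesOn]

theorem diracConst_stepsOnes (c : ZMod 2) {s : Finset ℕ} (hs : s.Nonempty) :
    (diracConst c : Measure Config) (stepsOnes s) = 0 := by
  change Measure.dirac _ _ = 0
  rw [Measure.dirac_apply' _ (measurableSet_stepsOnes s), Set.indicator_of_notMem]
  obtain ⟨i, hi⟩ := hs
  intro h
  simpa [steps] using mem_onesOn.1 h i hi

/-- Constants have no steps equal to `1`, so for nonempty `s` only the walks contribute, and the
moments of `m` can be read off the mixture. -/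
theorem mixture_real_stepsOnes (a b : ℝ≥0∞) (m : Measure I) {s : Finset ℕ}
    (hs : s.Nonempty) : (mixture a b m).real (stepsOnes s) = ∫ q, (q : ℝ) ^ s.card ∂m := by
  rw [measureReal_def, mixture_apply _ _ _ (measurableSet_stepsOnes s),
    diracConst_stepsOnes 0 hs, diracConst_stepsOnes 1 hs, mul_zero, mul_zero, zero_add, zero_add,
    integral_eq_lintegral_of_nonneg_ae (ae_of_all _ fun q => pow_nonneg q.2.1 _) (by fun_prop)]
  congr 1
  refine lintegral_congr fun q => ?_
  rw [randomWalk_stepsOnes, ENNReal.ofReal_pow q.2.1]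

theorem mem_extremeMeasures_iff {S : Set (ProbabilityMeasure Config)}
    {μ : ProbabilityMeasure Config} :
    μ ∈ extremeMeasures S ↔ μ ∈ S ∧ ∀ ν₁ ∈ S, ∀ ν₂ ∈ S, ∀ s t : ℝ≥0, 0 < s → 0 < t → s + t = 1 →
      s • (ν₁ : Measure Config) + t • (ν₂ : Measure Config) = μ → ν₁ = μ := by
  simp only [extremeMeasures, Set.extremePoints, Set.mem_ofPred_eq, openSegment]
  constructor
  · rintro ⟨⟨ν, hν, h⟩, h2⟩
    rw [ProbabilityMeasure.toMeasure_injective h] at hν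
    refine ⟨hν, fun ν₁ h₁ ν₂ h₂ s t hs ht hst he => ?_⟩
    exact ProbabilityMeasure.toMeasure_injective
      (h2 ⟨ν₁, h₁, rfl⟩ ⟨ν₂, h₂, rfl⟩ ⟨s, t, hs, ht, hst, he⟩)
  · rintro ⟨h, h2⟩
    refine ⟨⟨μ, h, rfl⟩, ?_⟩
    rintro _ ⟨ν₁, h₁, rfl⟩ _ ⟨ν₂, h₂, rfl⟩ ⟨s, t, hs, ht, hst, he⟩
    rw [h2 ν₁ h₁ ν₂ h₂ s t hs ht hst he]

/-- A component of positive weight is null wherever the point mass is null. -/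
theorem diracConst_mem_extremeMeasures (c : ZMod 2) :
    diracConst c ∈ extremeMeasures (exchOn (faceSumZero 2)) := by
  refine mem_extremeMeasures_iff.2 ⟨diracConst_mem_exchOn c, fun ν₁ _ ν₂ _ s t hs _ _ he => ?_⟩
  have h0 : (ν₁ : Measure Config) {fun _ => c}ᶜ = 0 := by
    have := congrArg (fun ρ : Measure Config => ρ {fun _ => c}ᶜ) he
    have hd : (diracConst c : Measure Config) {fun _ => c}ᶜ = 0 := by
      change Measure.dirac _ _ = 0
      simp
    simp only [hd, Measure.add_apply, Measure.smul_apply] at this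
    rw [add_eq_zero, ENNReal.smul_def, smul_eq_mul, mul_eq_zero] at this
    rcases this.1 with h | h
    · exact absurd (by exact_mod_cast h) hs.ne'
    · exact h
  refine ProbabilityMeasure.toMeasure_injective ?_
  have h1 : ∀ᵐ ω ∂(ν₁ : Measure Config), ω = fun _ => c := h0
  ext A hA
  change _ = Measure.dirac _ A
  rw [Measure.dirac_apply' _ hA]
  by_cases h : (fun _ : Cube => c) ∈ A
  · rw [Set.indicator_of_mem h, Pi.one_apply, ← prob_compl_eq_zero_iff hA]
    refine measure_mono_null ?_ h0
    rintro ω hω rfl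
    exact hω h
  · rw [Set.indicator_of_notMem h]
    refine measure_mono_null ?_ h0
    rintro ω hω rfl
    exact h hω

theorem eq_dirac_of_integral_sq_eq_zero {m : Measure I} [IsFiniteMeasure m] {p : I}
    (h : ∫ q, ((q : ℝ) - p) ^ 2 ∂m = 0) : m = m Set.univ • Measure.dirac p := by
  have hint : Integrable (fun q : I => ((q : ℝ) - p) ^ 2) m :=
    Continuous.integrable_of_hasCompactSupport (by fun_prop) (HasCompactSupport.of_compactSpace _)
  rw [integral_eq_zero_iff_of_nonneg (fun q => sq_nonneg _) hint] at h
  have hae : ∀ᵐ q ∂m, q = p := by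
    filter_upwards [h] with q hq
    exact Subtype.ext (sub_eq_zero.1 (pow_eq_zero_iff (two_ne_zero)|>.1 hq))
  have : m.map id = m.map fun _ => p := Measure.map_congr hae
  rwa [Measure.map_id, Measure.map_const] at this

theorem integrable_coe_pow (m : Measure I) [IsFiniteMeasure m] (k : ℕ) :
    Integrable (fun q : I => (q : ℝ) ^ k) m :=
  Continuous.integrable_of_hasCompactSupport (by fun_prop) (HasCompactSupport.of_compactSpace _)

theorem mixture_dirac (p : I) :
    mixture 0 0 (Measure.dirac p) = (randomWalk p : Measure Config) := by
  rw [mixture, Measure.dirac_bind measurable_randomWalk]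
  simp

/-- The mean square deviation from `p` of the step frequencies. -/
noncomputable def stepVariance (p : I) (μ : Measure Config) : ℝ :=
  μ.real (stepsOnes {0, 1}) - 2 * p * μ.real (stepsOnes {0}) + (p : ℝ) ^ 2 * μ.real Set.univ

/-- The constants behave like walks of frequency `0` and contribute `p ^ 2` per unit of mass. For `p
> 0` this penalty is what forces `a + b = 0` when the variance vanishes. -/
theorem stepVariance_mixture (p : I) {a b : ℝ≥0∞} {m : Measure I} (h : a + b + m Set.univ = 1) :
    stepVariance p (mixture a b m) =
      ∫ q, ((q : ℝ) - p) ^ 2 ∂m + (p : ℝ) ^ 2 * (a + b).toReal := by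
  have hm : IsFiniteMeasure m := ⟨by
    refine lt_of_le_of_lt ?_ ENNReal.one_lt_top
    rw [← h]
    exact le_add_self⟩
  have hab : a + b ≠ ⊤ := by
    refine ne_top_of_le_ne_top ENNReal.one_ne_top ?_
    rw [← h]
    exact le_self_add
  have hu : (mixture a b m).real Set.univ = (a + b).toReal + m.real Set.univ := by
    rw [measureReal_def, mixture_univ, ENNReal.toReal_add hab (measure_ne_top m _)]
    rfl
  have hexp : ∫ q, ((q : ℝ) - p) ^ 2 ∂m =
      ∫ q, (q : ℝ) ^ 2 ∂m - 2 * p * ∫ q, (q : ℝ) ^ 1 ∂m + (p : ℝ) ^ 2 * m.real Set.univ := by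
    have h1 := integrable_coe_pow m 1
    have h2 := integrable_coe_pow m 2
    have h3 : (p : ℝ) ^ 2 * m.real Set.univ = ∫ _, (p : ℝ) ^ 2 ∂m := by
      rw [integral_const, smul_eq_mul, mul_comm]
    have h4 : (fun q : I => ((q : ℝ) - p) ^ 2) =
        fun q : I => (q : ℝ) ^ 2 - 2 * p * (q : ℝ) ^ 1 + (p : ℝ) ^ 2 := by
      ext q
      ring
    have h5 : Integrable (fun q : I => (q : ℝ) ^ 2 - 2 * p * (q : ℝ) ^ 1) m :=
      h2.sub (h1.const_mul _)
    rw [h4, integral_add h5 (integrable_const _), integral_sub h2 (h1.const_mul _), integral_const_mul, h3]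
  rw [stepVariance, mixture_real_stepsOnes _ _ _ (by simp), mixture_real_stepsOnes _ _ _ (by simp),
    hu, hexp]
  simp only [Finset.card_singleton, Finset.card_pair zero_ne_one]
  ring

theorem stepVariance_nonneg (p : I) {μ : ProbabilityMeasure Config}
    (hμ : μ ∈ exchOn (faceSumZero 2)) : 0 ≤ stepVariance p (μ : Measure Config) := by
  obtain ⟨a, b, m, h, hm⟩ := exists_eq_mixture hμ
  rw [hm, stepVariance_mixture p h]
  have : 0 ≤ ∫ q, ((q : ℝ) - p) ^ 2 ∂m := integral_nonneg fun q => sq_nonneg _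
  positivity

theorem eq_randomWalk_of_stepVariance_eq_zero {p : I} (hp : 0 < p) {μ : ProbabilityMeasure Config}
    (hμ : μ ∈ exchOn (faceSumZero 2)) (h0 : stepVariance p (μ : Measure Config) = 0) :
    μ = randomWalk p := by
  obtain ⟨a, b, m, h, hm⟩ := exists_eq_mixture hμ
  rw [hm, stepVariance_mixture p h] at h0
  have h1 : 0 ≤ ∫ q, ((q : ℝ) - p) ^ 2 ∂m := integral_nonneg fun q => sq_nonneg _
  have hp' : (0 : ℝ) < (p : ℝ) ^ 2 := pow_pos hp 2
  have h2 : 0 ≤ (p : ℝ) ^ 2 * (a + b).toReal := by positivity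
  have h3 : ∫ q, ((q : ℝ) - p) ^ 2 ∂m = 0 := by linarith
  have h4 : (a + b).toReal = 0 := by
    have : (p : ℝ) ^ 2 * (a + b).toReal = 0 := by linarith
    exact (mul_eq_zero.1 this).resolve_left hp'.ne'
  have hab : a + b ≠ ⊤ := by
    refine ne_top_of_le_ne_top ENNReal.one_ne_top ?_
    rw [← h]
    exact le_self_add
  have h5 : a + b = 0 := (ENNReal.toReal_eq_zero_iff _).1 h4 |>.resolve_right hab
  rw [h5, zero_add] at h
  have hmp : IsProbabilityMeasure m := ⟨h⟩
  have h6 := eq_dirac_of_integral_sq_eq_zero h3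
  rw [h, one_smul] at h6
  obtain ⟨rfl, rfl⟩ := add_eq_zero.1 h5
  refine ProbabilityMeasure.toMeasure_injective ?_
  rw [hm, h6, mixture_dirac]

theorem stepVariance_randomWalk (p : I) : stepVariance p (randomWalk p : Measure Config) = 0 := by
  rw [← mixture_dirac, stepVariance_mixture p (by simp)]
  simp

/-- `stepVariance p` is linear in the measure, nonnegative on the simplex, and zero there only at
this walk; both components of a decomposition must therefore have variance zero. -/
theorem randomWalk_mem_extremeMeasures {p : I} (hp : 0 < p) :
    randomWalk p ∈ extremeMeasures (exchOn (faceSumZero 2)) := by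
  refine mem_extremeMeasures_iff.2 ⟨randomWalk_mem_exchOn p, fun ν₁ h₁ ν₂ h₂ s t hs ht _ he => ?_⟩
  refine eq_randomWalk_of_stepVariance_eq_zero hp h₁ ?_
  have key : (s : ℝ) * stepVariance p ν₁ + t * stepVariance p ν₂ = 0 := by
    have hadd (A : Set Config) : (randomWalk p : Measure Config).real A =
        s * (ν₁ : Measure Config).real A + t * (ν₂ : Measure Config).real A := by
      rw [← he, measureReal_add_apply, measureReal_nnreal_smul_apply,
        measureReal_nnreal_smul_apply]
    rw [← stepVariance_randomWalk p]
    simp only [stepVariance, hadd]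
    ring
  have h3 := mul_nonneg s.2 (stepVariance_nonneg p h₁)
  have h4 := mul_nonneg t.2 (stepVariance_nonneg p h₂)
  have h5 : (s : ℝ) * stepVariance p ν₁ = 0 := le_antisymm (by
    change (0 : ℝ) ≤ (t : ℝ) * _ at h4
    linarith) h3
  exact (mul_eq_zero.1 h5).resolve_left (by exact_mod_cast hs.ne')

/-- A nontrivial part of an extreme mixture is proportional to it. -/
theorem mixture_eq_smul_of_extreme {μ : ProbabilityMeasure Config}
    (hμ : μ ∈ extremeMeasures (exchOn (faceSumZero 2))) {a₁ a₂ b₁ b₂ : ℝ≥0∞} {m₁ m₂ : Measure I}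
    (h : (μ : Measure Config) = mixture a₁ b₁ m₁ + mixture a₂ b₂ m₂)
    (h₁ : mixture a₁ b₁ m₁ Set.univ ≠ 0) :
    mixture a₁ b₁ m₁ = mixture a₁ b₁ m₁ Set.univ • (μ : Measure Config) := by
  -- A zero second part cannot be normalised, but then the first part is all of `μ`.
  by_cases h₂ : mixture a₂ b₂ m₂ = 0
  · rw [h₂, add_zero] at h
    rw [← h, measure_univ, one_smul]
  have h₂ : mixture a₂ b₂ m₂ Set.univ ≠ 0 := by simpa using h₂
  set M₁ := mixture a₁ b₁ m₁ Set.univ with hM₁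
  set M₂ := mixture a₂ b₂ m₂ Set.univ with hM₂
  have hsum : M₁ + M₂ = 1 := by
    rw [hM₁, hM₂, ← Measure.add_apply, ← h, measure_univ]
  have ht₁ : M₁ ≠ ⊤ := ne_top_of_le_ne_top ENNReal.one_ne_top (hsum ▸ le_self_add)
  have ht₂ : M₂ ≠ ⊤ := ne_top_of_le_ne_top ENNReal.one_ne_top (hsum ▸ le_add_self)
  have hscale (r a b : ℝ≥0∞) (m : Measure I) :
      r • mixture a b m = mixture (r * a) (r * b) (r • m) := by
    ext A hA
    rw [Measure.smul_apply, mixture_apply _ _ _ hA, mixture_apply _ _ _ hA, lintegral_smul_measure]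
    simp only [smul_eq_mul]
    ring
  have hprob₁ : IsProbabilityMeasure (M₁⁻¹ • mixture a₁ b₁ m₁) :=
    ⟨by rw [Measure.smul_apply, smul_eq_mul, ← hM₁, ENNReal.inv_mul_cancel h₁ ht₁]⟩
  have hprob₂ : IsProbabilityMeasure (M₂⁻¹ • mixture a₂ b₂ m₂) :=
    ⟨by rw [Measure.smul_apply, smul_eq_mul, ← hM₂, ENNReal.inv_mul_cancel h₂ ht₂]⟩
  have hmem₁ : (⟨_, hprob₁⟩ : ProbabilityMeasure Config) ∈ exchOn (faceSumZero 2) :=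
    mem_exchOn_of_eq_mixture (hscale _ _ _ _)
  have hmem₂ : (⟨_, hprob₂⟩ : ProbabilityMeasure Config) ∈ exchOn (faceSumZero 2) :=
    mem_exchOn_of_eq_mixture (hscale _ _ _ _)
  have hcancel (r : ℝ≥0∞) (hr : r ≠ 0) (hr' : r ≠ ⊤) (ν : Measure Config) :
      r.toNNReal • r⁻¹ • ν = ν := by
    ext A _
    rw [Measure.smul_apply, Measure.smul_apply, ENNReal.smul_def, smul_eq_mul, smul_eq_mul,
      ENNReal.coe_toNNReal hr', ← mul_assoc, ENNReal.mul_inv_cancel hr hr', one_mul]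
  have := (mem_extremeMeasures_iff.1 hμ).2 _ hmem₁ _ hmem₂ M₁.toNNReal M₂.toNNReal
    (ENNReal.toNNReal_pos h₁ ht₁) (ENNReal.toNNReal_pos h₂ ht₂)
    (by rw [← ENNReal.toNNReal_add ht₁ ht₂, hsum, ENNReal.toNNReal_one])
    (by simp only [ProbabilityMeasure.coe_mk]; rw [hcancel _ h₁ ht₁, hcancel _ h₂ ht₂, h])
  rw [← this, ProbabilityMeasure.coe_mk, smul_smul, ENNReal.mul_inv_cancel h₁ ht₁, one_smul]

theorem mixture_add (a₁ a₂ b₁ b₂ : ℝ≥0∞) (m₁ m₂ : Measure I) :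
    mixture a₁ b₁ m₁ + mixture a₂ b₂ m₂ = mixture (a₁ + a₂) (b₁ + b₂) (m₁ + m₂) := by
  ext A hA
  rw [Measure.add_apply, mixture_apply _ _ _ hA, mixture_apply _ _ _ hA, mixture_apply _ _ _ hA,
    lintegral_add_measure]
  ring

theorem smul_injective_of_eq {μ ν : ProbabilityMeasure Config} {r : ℝ≥0∞} (hr : r ≠ 0)
    (hr' : r ≠ ⊤) (h : r • (μ : Measure Config) = r • (ν : Measure Config)) : μ = ν := by
  refine ProbabilityMeasure.toMeasure_injective ?_
  have := congrArg (fun ρ => r⁻¹ • ρ) h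
  simpa [smul_smul, ENNReal.inv_mul_cancel hr hr'] using this

theorem ne_top_of_eq_mixture {μ : ProbabilityMeasure Config} {a b : ℝ≥0∞} {m : Measure I}
    (h : (μ : Measure Config) = mixture a b m) : a ≠ ⊤ ∧ b ≠ ⊤ ∧ m Set.univ ≠ ⊤ := by
  have : a + b + m Set.univ ≠ ⊤ := by
    rw [← mixture_univ, ← h, measure_univ]
    exact ENNReal.one_ne_top
  simp only [ne_eq, ENNReal.add_eq_top, not_or] at this
  tauto

theorem eq_diracConst_zero_of_extreme {μ : ProbabilityMeasure Config}
    (hμ : μ ∈ extremeMeasures (exchOn (faceSumZero 2))) {a b : ℝ≥0∞} {m : Measure I}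
    (h : (μ : Measure Config) = mixture a b m) (ha : a ≠ 0) : μ = diracConst 0 := by
  have := mixture_eq_smul_of_extreme hμ (a₁ := a) (b₁ := 0) (m₁ := 0) (a₂ := 0) (b₂ := b) (m₂ := m)
    (by rw [mixture_add, h]; simp) (by rw [mixture_univ]; simpa using ha)
  rw [mixture_univ] at this
  simp only [add_zero, Measure.coe_zero, Pi.zero_apply] at this
  refine smul_injective_of_eq ha (ne_top_of_eq_mixture h).1 ?_
  rw [← this, mixture]
  simp

theorem eq_diracConst_one_of_extreme {μ : ProbabilityMeasure Config}
    (hμ : μ ∈ extremeMeasures (exchOn (faceSumZero 2))) {a b : ℝ≥0∞} {m : Measure I}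
    (h : (μ : Measure Config) = mixture a b m) (hb : b ≠ 0) : μ = diracConst 1 := by
  have := mixture_eq_smul_of_extreme hμ (a₁ := 0) (b₁ := b) (m₁ := 0) (a₂ := a) (b₂ := 0) (m₂ := m)
    (by rw [mixture_add, h]; simp) (by rw [mixture_univ]; simpa using hb)
  rw [mixture_univ] at this
  simp only [add_zero, zero_add, Measure.coe_zero, Pi.zero_apply] at this
  refine smul_injective_of_eq hb (ne_top_of_eq_mixture h).2.1 ?_
  rw [← this, mixture]
  simp

/-- Let `c` be the mean of `m`. If `{q < c}` had positive mass, its normalised part would again be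
`μ` and have mean `c`, although its frequencies lie below `c`. So `q ≥ c` almost surely, and having
mean `c` forces `q = c`. -/
theorem eq_randomWalk_of_extreme {μ : ProbabilityMeasure Config}
    (hμ : μ ∈ extremeMeasures (exchOn (faceSumZero 2))) {m : Measure I}
    (h : (μ : Measure Config) = mixture 0 0 m) : ∃ p, μ = randomWalk p := by
  have hm : IsProbabilityMeasure m := ⟨by
    have := congrArg (fun ρ : Measure Config => ρ Set.univ) h
    simpa [mixture_univ] using this.symm⟩
  have hid : Integrable (fun q : I => (q : ℝ)) m := by simpa using integrable_coe_pow m 1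
  set c : ℝ := ∫ q, (q : ℝ) ∂m with hc
  have hcI : c ∈ I := by
    refine ⟨integral_nonneg fun q => q.2.1, ?_⟩
    have := integral_mono hid (integrable_const (1 : ℝ)) fun q => q.2.2
    simpa using this
  have hB : MeasurableSet {q : I | (q : ℝ) < c} := measurableSet_lt (by fun_prop) (by fun_prop)
  have hμc : (μ : Measure Config).real (stepsOnes {0}) = c := by
    rw [h, mixture_real_stepsOnes _ _ _ (by simp)]
    simp [hc]
  have hB0 : m {q : I | (q : ℝ) < c} = 0 := by
    by_contra hne
    have hu : mixture 0 0 (m.restrict {q : I | (q : ℝ) < c}) Set.univ =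
        m {q : I | (q : ℝ) < c} := by simp [mixture_univ]
    have hs := mixture_eq_smul_of_extreme hμ (a₁ := 0) (b₁ := 0)
      (m₁ := m.restrict {q : I | (q : ℝ) < c}) (a₂ := 0) (b₂ := 0)
      (m₂ := m.restrict {q : I | (q : ℝ) < c}ᶜ)
      (by rw [mixture_add, Measure.restrict_add_restrict_compl hB, h]; simp)
      (by rwa [hu])
    have hr := congrArg (fun ρ : Measure Config => ρ.real (stepsOnes {0})) hs
    simp only [hu, measureReal_ennreal_smul_apply, hμc,
      mixture_real_stepsOnes _ _ _ (Finset.singleton_nonempty 0), Finset.card_singleton,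
      pow_one] at hr
    have hz : ∫ q in {q : I | (q : ℝ) < c}, (c - q) ∂m = 0 := by
      rw [integral_sub (integrable_const _) hid.integrableOn, hr]
      simp [measureReal_def]
    rw [setIntegral_eq_zero_iff_of_nonneg_ae] at hz
    · have hf : ∀ᵐ q ∂(m.restrict {q : I | (q : ℝ) < c}), False := by
        filter_upwards [hz, ae_restrict_mem hB] with q h1 h2
        have h1 : c - q = 0 := h1
        have h2 : (q : ℝ) < c := h2
        linarith
      rw [ae_iff] at hf
      simp at hf
      exact hne hf
    · filter_upwards [ae_restrict_mem hB] with q h2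
      exact sub_nonneg.2 (le_of_lt h2)
    · exact ((integrable_const _).sub hid).integrableOn
  have hge : ∀ᵐ q : I ∂m, (0 : ℝ) ≤ q - c := by
    rw [ae_iff]
    convert hB0 using 3
    ext q
    simp
  have hz : ∫ q, ((q : ℝ) - c) ∂m = 0 := by
    rw [integral_sub hid (integrable_const _)]
    simp [hc]
  rw [integral_eq_zero_iff_of_nonneg_ae hge (hid.sub (integrable_const _))] at hz
  refine ⟨⟨c, hcI⟩, ProbabilityMeasure.toMeasure_injective ?_⟩
  have hsq : ∫ q, ((q : ℝ) - (⟨c, hcI⟩ : I)) ^ 2 ∂m = 0 := by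
    rw [integral_eq_zero_of_ae]
    filter_upwards [hz] with q hq
    have hq : (q : ℝ) - c = 0 := hq
    simp [hq]
  have hd := eq_dirac_of_integral_sq_eq_zero hsq
  rw [measure_univ, one_smul] at hd
  rw [h, hd, mixture_dirac]

theorem extremeMeasures_eq :
    extremeMeasures (exchOn (faceSumZero 2)) =
      {diracConst 0, diracConst 1} ∪ randomWalk '' {p : I | 0 < p} := by
  ext μ
  constructor
  · intro hμ
    obtain ⟨a, b, m, -, h⟩ := exists_eq_mixture (mem_extremeMeasures_iff.1 hμ).1
    by_cases ha : a = 0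
    · by_cases hb : b = 0
      · subst ha hb
        obtain ⟨p, rfl⟩ := eq_randomWalk_of_extreme hμ h
        rcases eq_or_lt_of_le (unitInterval.nonneg' (t := p)) with hp | hp
        · subst hp
          -- The walk at `p = 0` is the fair mixture of the constants. Were it extreme, its part at
          -- `0` would force it to be `diracConst 0`, so this impossible case still lands in the
          -- set.
          refine Or.inl (Or.inl (eq_diracConst_zero_of_extreme hμ (a := 2⁻¹) (b := 2⁻¹) (m := 0)
            ?_ (by simp)))
          rw [randomWalk_zero, mixture, Measure.bind_zero_left, add_zero]
          rfl
        · exact Or.inr ⟨p, hp, rfl⟩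
      · exact Or.inl (Or.inr (eq_diracConst_one_of_extreme hμ h hb))
    · exact Or.inl (Or.inl (eq_diracConst_zero_of_extreme hμ h ha))
  · rintro ((rfl | rfl) | ⟨p, hp, rfl⟩)
    · exact diracConst_mem_extremeMeasures 0
    · exact diracConst_mem_extremeMeasures 1
    · exact randomWalk_mem_extremeMeasures hp

/-! ### Ergodicity and cluster points of the extreme points -/

theorem cond_mem_exchOn {μ : ProbabilityMeasure Config} {Ω : Set Config} (hμ : μ ∈ exchOn Ω)
    {A : Set Config} (hA : MeasurableSet A) (hinv : ∀ γ ∈ cubeIsom, shift γ ⁻¹' A = A)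
    (h : IsProbabilityMeasure ((μ : Measure Config)[|A])) :
    (⟨(μ : Measure Config)[|A], h⟩ : ProbabilityMeasure Config) ∈ exchOn Ω := by
  refine ⟨fun γ hγ => ?_, ?_⟩
  · change ((μ : Measure Config)[|A]).map (shift γ) = (μ : Measure Config)[|A]
    rw [ProbabilityTheory.cond, Measure.map_smul]
    congr 1
    conv_lhs => rw [← hinv γ hγ, ← Measure.restrict_map (measurable_shift γ) hA, hμ.1 γ hγ]
  · exact cond_absolutelyContinuous.ae_le hμ.2

/-- An invariant event of intermediate probability splits the measure into its conditionings on the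
event and on the complement, both of which stay in the simplex. -/
theorem isErgodic_of_mem_extremeMeasures {Ω : Set Config} {μ : ProbabilityMeasure Config}
    (hμ : μ ∈ extremeMeasures (exchOn Ω)) : IsErgodic μ := by
  intro A hA hinv
  by_contra! hne
  obtain ⟨h0, h1⟩ := hne
  have hc0 : (μ : Measure Config) Aᶜ ≠ 0 := by
    rwa [Ne, prob_compl_eq_zero_iff hA]
  obtain ⟨hmem, hext⟩ := mem_extremeMeasures_iff.1 hμ
  have hp₁ := cond_isProbabilityMeasure h0
  have hp₂ := cond_isProbabilityMeasure hc0
  have hmem₁ := cond_mem_exchOn hmem hA hinv hp₁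
  have hmem₂ := cond_mem_exchOn hmem hA.compl
    (fun γ hγ => by rw [Set.preimage_compl, hinv γ hγ]) hp₂
  have heq := hext _ hmem₁ _ hmem₂ ((μ : Measure Config) A).toNNReal
    ((μ : Measure Config) Aᶜ).toNNReal (ENNReal.toNNReal_pos h0 (measure_ne_top _ _))
    (ENNReal.toNNReal_pos hc0 (measure_ne_top _ _))
    (by rw [← ENNReal.toNNReal_add (measure_ne_top _ _) (measure_ne_top _ _),
      prob_add_prob_compl hA, ENNReal.toNNReal_one])
    (by
      ext B hB
      simp only [ProbabilityMeasure.coe_mk, Measure.add_apply, Measure.smul_apply,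
        ENNReal.smul_def, smul_eq_mul, ENNReal.coe_toNNReal (measure_ne_top _ _)]
      rw [mul_comm, cond_mul_eq_inter hA, mul_comm, cond_mul_eq_inter hA.compl, Set.inter_comm A,
        Set.inter_comm Aᶜ, ← Set.sdiff_eq, measure_inter_add_sdiff _ hA])
  refine h1 ?_
  rw [← heq, ProbabilityMeasure.coe_mk, cond_apply hA, Set.inter_self,
    ENNReal.inv_mul_cancel h0 (measure_ne_top _ _)]

theorem shift_preimage_const_zero (γ : Equiv.Perm Cube) :
    shift γ ⁻¹' {fun _ => (0 : ZMod 2)} = {fun _ => 0} := by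
  ext ω
  simp only [Set.mem_preimage, Set.mem_singleton_iff, funext_iff, shift]
  exact ⟨fun h v => by simpa using h (γ.symm v), fun h v => h _⟩

theorem mixture_const_zero (a b : ℝ≥0∞) :
    mixture a b 0 {fun _ => (0 : ZMod 2)} = a := by
  rw [mixture_apply _ _ _ (measurableSet_singleton _)]
  change a * Measure.dirac _ _ + b * Measure.dirac _ _ + _ = a
  have : (fun _ : Cube => (1 : ZMod 2)) ≠ fun _ => 0 := fun h => one_ne_zero (congrFun h 0)
  rw [Measure.dirac_apply' _ (measurableSet_singleton _),
    Measure.dirac_apply' _ (measurableSet_singleton _)]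
  simp [this]

/-- The invariant event of being identically zero has probability exactly `a`. -/
theorem not_isErgodic_of_eq_mixture {μ : ProbabilityMeasure Config} {a b : ℝ≥0∞}
    (h : (μ : Measure Config) = mixture a b 0) (h0 : a ≠ 0) (h1 : a ≠ 1) : ¬ IsErgodic μ := by
  intro he
  have := he _ (measurableSet_singleton _) fun γ _ => shift_preimage_const_zero γ
  rw [h, mixture_const_zero] at this
  tauto

theorem coe_halfHalf_eq_mixture : (halfHalf : Measure Config) = mixture 2⁻¹ 2⁻¹ 0 := by
  rw [mixture, Measure.bind_zero_left, add_zero]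
  rfl

theorem not_isErgodic_halfHalf : ¬ IsErgodic halfHalf :=
  not_isErgodic_of_eq_mixture coe_halfHalf_eq_mixture (by simp) (by simp)

/-- Adding the walk at `p = 0` to the extreme points gives a compact, hence closed, set. This walk
is its only member that can fail to be ergodic. -/
theorem mem_closure_extremeMeasures {μ : ProbabilityMeasure Config}
    (hμ : μ ∈ closure (extremeMeasures (exchOn (faceSumZero 2)))) (he : ¬ IsErgodic μ) :
    μ = halfHalf := by
  have hK : IsClosed ({diracConst 0, diracConst 1} ∪ Set.range randomWalk) :=
    (Set.toFinite _).isClosed.union (isCompact_range continuous_randomWalk).isClosed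
  have hsub : closure (extremeMeasures (exchOn (faceSumZero 2))) ⊆
      {diracConst 0, diracConst 1} ∪ Set.range randomWalk := by
    refine closure_minimal ?_ hK
    rw [extremeMeasures_eq]
    exact Set.union_subset_union_right _ (Set.image_subset_range _ _)
  have hne : μ ∉ extremeMeasures (exchOn (faceSumZero 2)) :=
    fun h => he (isErgodic_of_mem_extremeMeasures h)
  rw [extremeMeasures_eq] at hne
  rcases hsub hμ with h | ⟨p, rfl⟩
  · exact absurd (Or.inl h) hne
  · rcases eq_or_lt_of_le (unitInterval.nonneg' (t := p)) with hp | hp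
    · rw [← hp, randomWalk_zero]
    · exact absurd (Or.inr ⟨p, hp, rfl⟩) hne

theorem accPt_halfHalf :
    AccPt halfHalf (𝓟 (extremeMeasures (exchOn (faceSumZero 2)))) := by
  have : (𝓝[>] (0 : I)).NeBot := nhdsGT_neBot_of_exists_gt ⟨1, zero_lt_one⟩
  rw [accPt_iff_frequently]
  have ht : Tendsto randomWalk (𝓝[>] 0) (𝓝 halfHalf) := by
    rw [← randomWalk_zero]
    exact continuous_randomWalk.continuousAt.tendsto.mono_left nhdsWithin_le_nhds
  have hev : ∀ᶠ p in 𝓝[>] (0 : I), randomWalk p ≠ halfHalf ∧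
      randomWalk p ∈ extremeMeasures (exchOn (faceSumZero 2)) := by
    filter_upwards [self_mem_nhdsWithin] with p hp
    have := randomWalk_mem_extremeMeasures hp
    exact ⟨fun h => not_isErgodic_halfHalf (h ▸ isErgodic_of_mem_extremeMeasures this), this⟩
  exact ht.frequently hev.frequently

theorem nonergodic_accPt_eq :
    {μ : ProbabilityMeasure Config |
        AccPt μ (𝓟 (extremeMeasures (exchOn (faceSumZero 2)))) ∧ ¬ IsErgodic μ} = {halfHalf} := by
  ext μ
  constructor
  · rintro ⟨h, he⟩
    exact mem_closure_extremeMeasures (mem_closure_iff_clusterPt.2 h.clusterPt) he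
  · rintro rfl
    exact ⟨accPt_halfHalf, not_isErgodic_halfHalf⟩

theorem not_subset_closure_extremeMeasures :
    ¬ exchOn (faceSumZero 2) ⊆ closure (extremeMeasures (exchOn (faceSumZero 2))) := by
  intro hsub
  -- A mixture of the constants with a weight other than `0`, `1/2` and `1` is neither ergodic nor
  -- `halfHalf`.
  have hsum : (4⁻¹ : ℝ≥0∞) + (1 - 4⁻¹) = 1 :=
    add_tsub_cancel_of_le (ENNReal.inv_le_one.2 (by norm_num))
  have hprob : IsProbabilityMeasure (mixture 4⁻¹ (1 - 4⁻¹) 0) :=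
    ⟨by rw [mixture_univ]; simp [hsum]⟩
  set μ : ProbabilityMeasure Config := ⟨_, hprob⟩ with hμ
  have hμm : (μ : Measure Config) = mixture 4⁻¹ (1 - 4⁻¹) 0 := rfl
  have h := mem_closure_extremeMeasures (hsub (mem_exchOn_of_eq_mixture hμm))
    (not_isErgodic_of_eq_mixture hμm (by simp) (by simp))
  have := congrArg (fun ν : ProbabilityMeasure Config =>
    (ν : Measure Config) {fun _ => (0 : ZMod 2)}) h
  simp only [hμm, coe_halfHalf_eq_mixture, mixture_const_zero] at this
  simp at this

/-! ### Joining neighbourhoods are vague neighbourhoods -/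

theorem isClopen_setOf_ne (v : Cube) : IsClopen {q : Config × Config | q.1 v ≠ q.2 v} :=
  (isClopen_discrete {c : ZMod 2 × ZMod 2 | c.1 ≠ c.2}).preimage
    (f := fun q : Config × Config => (q.1 v, q.2 v)) (by fun_prop)

theorem measurable_prodMap_shift (γ : Equiv.Perm Cube) :
    Measurable (Prod.map (shift γ) (shift γ)) :=
  (measurable_shift γ).prodMap (measurable_shift γ)

/-- The probability of a disagreement does not depend on the reference index. -/
theorem measure_setOf_ne_eq {lam : ProbabilityMeasure (Config × Config)}
    (h : ∀ γ ∈ cubeIsom,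
      (lam : Measure (Config × Config)).map (Prod.map (shift γ) (shift γ)) = lam) (v w : Cube) :
    (lam : Measure (Config × Config)) {q | q.1 w ≠ q.2 w} =
      (lam : Measure (Config × Config)) {q | q.1 v ≠ q.2 v} := by
  conv_rhs => rw [← h _ (addRight_mem_cubeIsom (w - v)),
    Measure.map_apply (measurable_prodMap_shift _) (isClopen_setOf_ne v).isOpen.measurableSet]
  congr 1
  ext q
  simp [shift]

theorem fst_eq_snd_of_measure_ne_eq_zero {lam : ProbabilityMeasure (Config × Config)}
    (h : ∀ γ ∈ cubeIsom,
      (lam : Measure (Config × Config)).map (Prod.map (shift γ) (shift γ)) = lam) {v : Cube}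
    (h0 : (lam : Measure (Config × Config)) {q | q.1 v ≠ q.2 v} = 0) :
    (lam : Measure (Config × Config)).map Prod.fst =
      (lam : Measure (Config × Config)).map Prod.snd := by
  refine Measure.map_congr ?_
  have : ∀ w : Cube, ∀ᵐ q ∂(lam : Measure (Config × Config)), q.1 w = q.2 w := fun w => by
    rw [ae_iff, measure_setOf_ne_eq h v w, h0]
  filter_upwards [ae_all_iff.2 this] with q hq
  exact funext hq

/-- The joinings with second marginal in `S` and first marginal outside an open `U ⊇ S` form a
compact set. The disagreement probability is continuous and positive on it, so its minimum is a
valid `ε`. -/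
theorem joiningNhds_le_vagueNhds (v : Cube) {S : Set (ProbabilityMeasure Config)}
    (hS : IsClosed S) : joiningNhds v S ≤ vagueNhds S := by
  intro s hs
  rw [vagueNhds, mem_inf_principal, mem_nhdsSet_iff_exists] at hs
  obtain ⟨U, hU, hSU, hUs⟩ := hs
  set fstMap : ProbabilityMeasure (Config × Config) → ProbabilityMeasure Config :=
    fun lam => lam.map continuous_fst.measurable.aemeasurable with hfst
  set sndMap : ProbabilityMeasure (Config × Config) → ProbabilityMeasure Config :=
    fun lam => lam.map continuous_snd.measurable.aemeasurable with hsnd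
  have hfc : Continuous fstMap := ProbabilityMeasure.continuous_map continuous_fst
  have hsc : Continuous sndMap := ProbabilityMeasure.continuous_map continuous_snd
  set K : Set (ProbabilityMeasure (Config × Config)) :=
    (⋂ γ ∈ cubeIsom, {lam | (lam : Measure (Config × Config)).map
      (Prod.map (shift γ) (shift γ)) = lam}) ∩ (fstMap ⁻¹' Uᶜ ∩ sndMap ⁻¹' S) with hK
  have : SecondCountableTopology (ZMod 2) := inferInstance
  have : CompactSpace (ProbabilityMeasure (Config × Config)) := inferInstance
  have hKc : IsCompact K := by
    refine IsClosed.isCompact (IsClosed.inter ?_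
      ((hU.isClosed_compl.preimage hfc).inter (hS.preimage hsc)))
    exact isClosed_biInter fun γ _ =>
      isClosed_invariant ((continuous_shift γ).prodMap (continuous_shift γ))
  -- Zero disagreement at `v` spreads to all vertices by invariance and makes the marginals equal,
  -- but one is outside `U` and the other in `S ⊆ U`.
  have hpos : ∀ lam ∈ K, 0 < (lam : Measure (Config × Config)) {q | q.1 v ≠ q.2 v} := by
    rintro lam ⟨hinv, h1, h2⟩
    simp only [Set.mem_iInter] at hinv
    refine pos_iff_ne_zero.2 fun h0 => h1 (hSU ?_)
    have : fstMap lam = sndMap lam := ProbabilityMeasure.toMeasure_injective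
      (by simpa [hfst, hsnd] using fst_eq_snd_of_measure_ne_eq_zero hinv h0)
    rwa [this]
  obtain ⟨ε, hε, hK'⟩ : ∃ ε > 0, ∀ lam ∈ K,
      ε ≤ (lam : Measure (Config × Config)) {q | q.1 v ≠ q.2 v} := by
    rcases K.eq_empty_or_nonempty with h | h
    · exact ⟨1, one_pos, by simp [h]⟩
    · obtain ⟨l, hl, hmin⟩ := hKc.exists_isMinOn h
        (continuous_measure_of_isClopen (isClopen_setOf_ne v)).continuousOn
      exact ⟨_, hpos l hl, fun lam hlam => hmin hlam⟩
  refine mem_iInf_of_mem ε (mem_iInf_of_mem hε (mem_principal.2 ?_))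
  rintro μ ⟨hμ, ν, hν, hd⟩
  simp only [dbar, iInf_lt_iff] at hd
  obtain ⟨lam, hj, hlt⟩ := hd
  refine hUs ?_ hμ
  by_contra hμU
  have h1 : fstMap lam = μ := ProbabilityMeasure.toMeasure_injective (by simpa [hfst] using hj.map_fst)
  have h2 : sndMap lam = ν := ProbabilityMeasure.toMeasure_injective (by simpa [hsnd] using hj.map_snd)
  refine hlt.not_ge (hK' lam ⟨?_, ?_, ?_⟩)
  · simpa using hj.invariant
  · rwa [Set.mem_preimage, h1]
  · rwa [Set.mem_preimage, h2]

/-! ### Products of two random walks -/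

/-- The event that the sum over the parallelogram at the origin with sides `a` and `b` is not
zero. -/
def parallelogramFails (a b : Cube) : Set Config :=
  {ω | ω 0 + ω a + ω b + ω (a + b) ≠ 0}

theorem measurableSet_parallelogramFails (a b : Cube) :
    MeasurableSet (parallelogramFails a b) :=
  ((isClopen_discrete {c : ZMod 2 | c ≠ 0}).preimage
    (f := fun ω : Config => ω 0 + ω a + ω b + ω (a + b)) (by fun_prop)).isOpen.measurableSet

/-- The second configuration is affine and sums to zero on every parallelogram, so a failure in the
first needs a disagreement at one of the four vertices. The bound does not depend on the size of `a`
and `b`. -/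
theorem measure_parallelogramFails_le {lam : ProbabilityMeasure (Config × Config)}
    {μ ν : ProbabilityMeasure Config} (hj : IsJoining lam μ ν) (hν : ν ∈ exchOn (faceSumZero 2))
    (v a b : Cube) :
    (μ : Measure Config) (parallelogramFails a b) ≤
      4 * (lam : Measure (Config × Config)) {q | q.1 v ≠ q.2 v} := by
  set D : Cube → Set (Config × Config) := fun w => {q | q.1 w ≠ q.2 w} with hD
  have hmem : ∀ᵐ q ∂(lam : Measure (Config × Config)), q.2 ∈ faceSumZero 2 := by
    have := hν.2
    rw [← hj.map_snd] at this
    exact ae_of_ae_map measurable_snd.aemeasurable this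
  have hle : Prod.fst ⁻¹' parallelogramFails a b ≤ᵐ[(lam : Measure (Config × Config))]
      ((D 0 ∪ D a) ∪ (D b ∪ D (a + b)) : Set (Config × Config)) := by
    filter_upwards [hmem] with q hq hfail
    by_contra hcon
    simp only [hD, Set.mem_union, Set.mem_ofPred_eq, not_or, not_not,
      show ∀ A : Set (Config × Config), A q ↔ q ∈ A from fun _ => Iff.rfl] at hcon
    obtain ⟨⟨h0, ha⟩, hb, hab⟩ := hcon
    have := walkConfig_parallelogram (q.2 0, steps q.2) 0 a b
    rw [walkConfig_of_mem hq, zero_add, zero_add, ← h0, ← ha, ← hb, ← hab] at this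
    exact hfail this
  rw [← hj.map_fst, Measure.map_apply measurable_fst (measurableSet_parallelogramFails a b)]
  refine (measure_mono_ae hle).trans ?_
  have h4 : (4 : ℝ≥0∞) = (1 + 1) + (1 + 1) := by norm_num
  rw [h4, add_mul, add_mul, one_mul]
  refine (measure_union_le _ _).trans (add_le_add ((measure_union_le _ _).trans ?_)
    ((measure_union_le _ _).trans ?_))
  · exact add_le_add (measure_setOf_ne_eq hj.invariant v _).le
      (measure_setOf_ne_eq hj.invariant v _).le
  · exact add_le_add (measure_setOf_ne_eq hj.invariant v _).le
      (measure_setOf_ne_eq hj.invariant v _).le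

/-- The pointwise product of two configurations. -/
def mulConfig (q : Config × Config) : Config := fun v => q.1 v * q.2 v

theorem continuous_mulConfig : Continuous mulConfig := by
  unfold mulConfig; fun_prop

/-- The pointwise product of two independent random walks. -/
noncomputable def productWalk (p : I) : ProbabilityMeasure Config :=
  ((randomWalk p).prod (randomWalk p)).map continuous_mulConfig.measurable.aemeasurable

theorem coe_productWalk (p : I) :
    (productWalk p : Measure Config) =
      ((randomWalk p : Measure Config).prod (randomWalk p : Measure Config)).map mulConfig := rfl

theorem continuous_productWalk : Continuous productWalk :=
  (ProbabilityMeasure.continuous_map continuous_mulConfig).comp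
    (ProbabilityMeasure.continuous_prod.comp
      (continuous_randomWalk.prodMk continuous_randomWalk))

theorem productWalk_mem_exch (p : I) : productWalk p ∈ exch := by
  intro γ hγ
  have hinv := (randomWalk_mem_exchOn p).1 γ hγ
  rw [coe_productWalk, Measure.map_map (measurable_shift γ) continuous_mulConfig.measurable]
  conv_rhs => rw [← hinv, Measure.map_prod_map _ _ (measurable_shift γ) (measurable_shift γ),
    Measure.map_map continuous_mulConfig.measurable (measurable_prodMap_shift γ)]
  rfl

/-- At `p = 0` both factors are constant configurations, and so is their product. -/
theorem productWalk_zero_mem_exchOn : productWalk 0 ∈ exchOn (faceSumZero 2) := by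
  refine ⟨productWalk_mem_exch 0, ?_⟩
  have hconst : ∀ᵐ ω ∂(randomWalk 0 : Measure Config), ∃ c : ZMod 2, ω = fun _ => c := by
    rw [coe_randomWalk, bernoulliSteps_zero, Measure.prod_dirac,
      Measure.map_map measurable_walkConfig (by fun_prop)]
    have hm : Measurable fun c : ZMod 2 => walkConfig (c, 0) := measurable_from_top
    change ∀ᵐ ω ∂(coin.map fun c => walkConfig (c, 0)), _
    rw [ae_map_iff hm.aemeasurable]
    · exact ae_of_all _ fun c => ⟨c, walkConfig_zero_right c⟩
    · have : {ω : Config | ∃ c : ZMod 2, ω = fun _ => c} = ⋃ c : ZMod 2, {fun _ => c} := by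
        ext; simp [eq_comm]
      rw [this]
      exact MeasurableSet.iUnion fun c => measurableSet_singleton _
  refine (ae_map_iff continuous_mulConfig.measurable.aemeasurable
    (measurableSet_faceSumZero 2)).2 ?_
  have h1 := (Measure.quasiMeasurePreserving_fst (μ := (randomWalk 0 : Measure Config))
    (ν := (randomWalk 0 : Measure Config))).ae hconst
  have h2 := (Measure.quasiMeasurePreserving_snd (μ := (randomWalk 0 : Measure Config))
    (ν := (randomWalk 0 : Measure Config))).ae hconst
  change ∀ᵐ q ∂((randomWalk 0 : Measure Config).prod (randomWalk 0 : Measure Config)), _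
  filter_upwards [h1, h2] with q hc hd
  obtain ⟨c, hc⟩ := hc
  obtain ⟨d, hd⟩ := hd
  simp only [mulConfig, hc, hd]
  exact const_mem (c * d)

/-! ### Parities of Bernoulli steps via the character -/

/-- The nontrivial character of `𝔽₂`. -/
noncomputable def signChar (a : ZMod 2) : ℝ := if a = 0 then 1 else -1

theorem signChar_add (a b : ZMod 2) : signChar (a + b) = signChar a * signChar b := by
  rcases (by decide : ∀ a : ZMod 2, a = 0 ∨ a = 1) a with rfl | rfl <;>
  rcases (by decide : ∀ a : ZMod 2, a = 0 ∨ a = 1) b with rfl | rfl <;>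
  simp [signChar, show (1 : ZMod 2) + 1 = 0 from rfl]

theorem integral_signChar_bernoulli (p : I) :
    ∫ a, signChar a ∂(bernoulliMeasure (1 : ZMod 2) 0 p) = 1 - 2 * p := by
  rw [integral_bernoulliMeasure]
  simp [signChar]
  ring

theorem measurable_signChar : Measurable signChar := measurable_from_top

theorem measurable_sum_apply (s : Finset ℕ) :
    Measurable fun z : ℕ → ZMod 2 => ∑ i ∈ s, z i := by fun_prop

theorem integral_signChar_sum (p : I) (s : Finset ℕ) :
    ∫ z, signChar (∑ i ∈ s, z i) ∂(bernoulliSteps p) = (1 - 2 * (p : ℝ)) ^ s.card := by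
  induction s using Finset.induction_on with
  | empty => simp [signChar]
  | insert i s hi ih =>
    have hind : iIndepFun (fun (i : ℕ) (z : ℕ → ZMod 2) => z i) (bernoulliSteps p) :=
      iIndepFun_infinitePi (X := fun _ a => a) fun _ => measurable_id
    have h2 := hind.indepFun_finsetSum_of_notMem (fun i => measurable_pi_apply i) hi
    have h3 := h2.comp measurable_signChar measurable_signChar
    simp only [Finset.sum_insert hi, signChar_add, Finset.card_insert_of_notMem hi, pow_succ]
    rw [← ih]
    have h4 := h3.integral_mul_eq_mul_integral
      (measurable_signChar.comp (by fun_prop)).aestronglyMeasurable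
      (measurable_signChar.comp (by fun_prop)).aestronglyMeasurable
    have h5 : ∫ z, signChar (z i) ∂(bernoulliSteps p) = 1 - 2 * (p : ℝ) := by
      rw [← integral_signChar_bernoulli,
        ← Measure.infinitePi_map_eval (fun _ : ℕ => bernoulliMeasure (1 : ZMod 2) 0 p) i,
        integral_map (measurable_pi_apply i).aemeasurable measurable_signChar.aestronglyMeasurable]
    rw [← h5, mul_comm]
    simpa [Function.comp_def, Finset.sum_apply, mul_comm] using h4

theorem integrable_signChar_sum (p : I) (s : Finset ℕ) :
    Integrable (fun z : ℕ → ZMod 2 => signChar (∑ i ∈ s, z i)) (bernoulliSteps p) := by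
  refine Integrable.of_bound
    (measurable_signChar.comp (measurable_sum_apply s)).aestronglyMeasurable 1
    (ae_of_all _ fun z => ?_)
  unfold signChar
  split_ifs <;> simp

theorem measurableSet_sum_eq (s : Finset ℕ) (c : ZMod 2) :
    MeasurableSet {z : ℕ → ZMod 2 | ∑ i ∈ s, z i = c} :=
  measurable_sum_apply s (measurableSet_singleton c)

/-- The indicator of odd parity is `(1 - χ) / 2`, where `χ` is the character of the sum, whose mean
factorises by independence. -/
theorem bernoulliSteps_sum_eq_one (p : I) (s : Finset ℕ) :
    (bernoulliSteps p).real {z | ∑ i ∈ s, z i = 1} = (1 - (1 - 2 * (p : ℝ)) ^ s.card) / 2 := by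
  rw [← integral_indicator_one (measurableSet_sum_eq s 1), ← integral_signChar_sum p s]
  have h : ({z : ℕ → ZMod 2 | ∑ i ∈ s, z i = 1}.indicator 1 : (ℕ → ZMod 2) → ℝ) =
      fun z => (1 - signChar (∑ i ∈ s, z i)) / 2 := by
    ext1 z
    rcases (by decide : ∀ a : ZMod 2, a = 0 ∨ a = 1) (∑ i ∈ s, z i) with hz | hz <;>
      simp [hz, signChar]
  rw [h, integral_div, integral_sub (integrable_const _) (integrable_signChar_sum p s)]
  simp

theorem bernoulliSteps_sum_eq_one_and_sum_eq_zero (p : I) {s t : Finset ℕ} (hst : Disjoint s t) :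
    (bernoulliSteps p).real {z | ∑ i ∈ s, z i = 1 ∧ ∑ i ∈ t, z i = 0} =
      (1 - (1 - 2 * (p : ℝ)) ^ s.card + (1 - 2 * (p : ℝ)) ^ t.card -
        (1 - 2 * (p : ℝ)) ^ (s.card + t.card)) / 4 := by
  have hset : {z : ℕ → ZMod 2 | ∑ i ∈ s, z i = 1 ∧ ∑ i ∈ t, z i = 0} =
    {z | ∑ i ∈ s, z i = 1} ∩ {z | ∑ i ∈ t, z i = 0} := rfl
  rw [hset,
    ← integral_indicator_one ((measurableSet_sum_eq s 1).inter (measurableSet_sum_eq t 0)),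
    ← Finset.card_union_of_disjoint hst, ← integral_signChar_sum p s, ← integral_signChar_sum p t,
    ← integral_signChar_sum p (s ∪ t)]
  have h : (({z : ℕ → ZMod 2 | ∑ i ∈ s, z i = 1} ∩ {z | ∑ i ∈ t, z i = 0}).indicator 1 :
      (ℕ → ZMod 2) → ℝ) = fun z => (1 - signChar (∑ i ∈ s, z i) + signChar (∑ i ∈ t, z i) -
        signChar (∑ i ∈ s ∪ t, z i)) / 4 := by
    ext1 z
    rw [Finset.sum_union hst, signChar_add]
    rcases (by decide : ∀ a : ZMod 2, a = 0 ∨ a = 1) (∑ i ∈ s, z i) with hs | hs <;>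
    rcases (by decide : ∀ a : ZMod 2, a = 0 ∨ a = 1) (∑ i ∈ t, z i) with ht | ht <;>
      (simp [hs, ht, signChar]; try norm_num)
  have h1 := (integrable_const (μ := bernoulliSteps p) (1 : ℝ)).sub (integrable_signChar_sum p s)
  have h2 := h1.add (integrable_signChar_sum p t)
  rw [h, integral_div]
  congr 1
  have e1 := integral_sub h2 (integrable_signChar_sum p (s ∪ t))
  have e2 := integral_add h1 (integrable_signChar_sum p t)
  have e3 := integral_sub (integrable_const (μ := bernoulliSteps p) (1 : ℝ))
    (integrable_signChar_sum p s)
  simp only [Pi.add_apply, Pi.sub_apply] at e1 e2 e3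
  rw [e1, e2, e3]
  simp

theorem randomWalk_inter_preimage_steps (p : I) {E : Set (ℕ → ZMod 2)} (hE : MeasurableSet E) :
    (randomWalk p : Measure Config) (steps ⁻¹' E ∩ faceSumZero 2) = bernoulliSteps p E := by
  rw [bernoulliSteps_apply p hE]
  exact measure_inter_conull (randomWalk_mem_exchOn p).2

/-- For affine functions with linear parts `l₁` and `l₂`, the parallelogram sum of the product is
`l₁(a) l₂(b) + l₁(b) l₂(a)`, which equals `1` here whatever `l₂(a)` is. -/
theorem parallelogram_mulConfig_ne_zero {q : Config × Config} (h₁ : q.1 ∈ faceSumZero 2)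
    (h₂ : q.2 ∈ faceSumZero 2) {a b : Cube} (ha : lin (steps q.1) a = 1)
    (hb : lin (steps q.1) b = 0) (hb' : lin (steps q.2) b = 1) :
    mulConfig q ∈ parallelogramFails a b := by
  have e₁ (v : Cube) : q.1 v = q.1 0 + lin (steps q.1) v := by
    conv_lhs => rw [← walkConfig_of_mem h₁]
    rfl
  have e₂ (v : Cube) : q.2 v = q.2 0 + lin (steps q.2) v := by
    conv_lhs => rw [← walkConfig_of_mem h₂]
    rfl
  change q.1 0 * q.2 0 + q.1 a * q.2 a + q.1 b * q.2 b + q.1 (a + b) * q.2 (a + b) ≠ 0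
  rw [e₁ a, e₁ b, e₁ (a + b), e₂ a, e₂ b, e₂ (a + b), lin_add, lin_add, ha, hb, hb']
  generalize q.1 0 = x
  generalize q.2 0 = y
  generalize lin (steps q.2) a = z
  revert x y z
  decide

/-- However small `p` is, the parity of enough steps is nearly fair. Sides supported on disjoint
long blocks thus meet the failure criterion with probability bounded below independently of `p`. -/
theorem exists_productWalk_parallelogramFails {p : I} (hp : 0 < p) (hp' : (p : ℝ) < 1 / 2) :
    ∃ a b : Cube, ENNReal.ofReal (1 / 32) ≤
      (productWalk p : Measure Config) (parallelogramFails a b) := by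
  have hp0 : (0 : ℝ) < p := hp
  set r : ℝ := 1 - 2 * p with hr
  have hr0 : 0 ≤ r := by linarith
  obtain ⟨N, hN⟩ := exists_pow_lt_of_lt_one (by norm_num : (0 : ℝ) < 1 / 2)
    (by linarith : r < 1)
  set s := Finset.range N
  set t := Finset.Ico N (2 * N)
  have hs : s.card = N := Finset.card_range N
  have ht : t.card = N := by
    rw [Nat.card_Ico]
    omega
  have hst : Disjoint s t := by
    rw [Finset.disjoint_left]
    intro i hi hi'
    exact (Finset.mem_range.1 hi).not_ge (Finset.mem_Ico.1 hi').1
  refine ⟨∑ i ∈ s, Finsupp.single i 1, ∑ i ∈ t, Finsupp.single i 1, ?_⟩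
  set E : Set (ℕ → ZMod 2) := {z | ∑ i ∈ s, z i = 1 ∧ ∑ i ∈ t, z i = 0}
  set F : Set (ℕ → ZMod 2) := {z | ∑ i ∈ t, z i = 1}
  have hE : MeasurableSet E := (measurableSet_sum_eq s 1).inter (measurableSet_sum_eq t 0)
  have hF : MeasurableSet F := measurableSet_sum_eq t 1
  have hsub : (steps ⁻¹' E ∩ faceSumZero 2) ×ˢ (steps ⁻¹' F ∩ faceSumZero 2) ⊆
      mulConfig ⁻¹' parallelogramFails (∑ i ∈ s, Finsupp.single i 1)
        (∑ i ∈ t, Finsupp.single i 1) := by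
    rintro q ⟨⟨⟨hq1, hq2⟩, hq3⟩, hq4, hq5⟩
    exact parallelogram_mulConfig_ne_zero hq3 hq5 (by rwa [lin_sum_single])
      (by rwa [lin_sum_single]) (by rw [lin_sum_single]; exact hq4)
  rw [coe_productWalk, Measure.map_apply continuous_mulConfig.measurable
    (measurableSet_parallelogramFails _ _)]
  refine le_trans ?_ (measure_mono hsub)
  rw [Measure.prod_prod, randomWalk_inter_preimage_steps p hE,
    randomWalk_inter_preimage_steps p hF, ← ofReal_measureReal, ← ofReal_measureReal,
    ← ENNReal.ofReal_mul measureReal_nonneg, bernoulliSteps_sum_eq_one_and_sum_eq_zero p hst,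
    bernoulliSteps_sum_eq_one, hs, ht, ← hr, pow_add]
  refine ENNReal.ofReal_le_ofReal ?_
  have h0 : 0 ≤ r ^ N := pow_nonneg hr0 N
  -- From `r ^ N < 1/2` the first walk meets its conditions with probability at least `3/16` and the
  -- second with at least `1/4`; the product `3/64` exceeds `1/32`.
  have h1 : (1 - r ^ N + r ^ N - r ^ N * r ^ N) / 4 ≥ 3 / 16 := by nlinarith
  have h2 : (1 - r ^ N) / 2 ≥ 1 / 4 := by linarith
  calc (1 / 32 : ℝ) ≤ 3 / 16 * (1 / 4) := by norm_num
    _ ≤ _ := mul_le_mul h1 h2 (by norm_num) (by linarith)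

theorem not_vagueNhds_le_joiningNhds (v : Cube) :
    ¬ vagueNhds (exchOn (faceSumZero 2)) ≤ joiningNhds v (exchOn (faceSumZero 2)) := by
  intro hle
  -- This choice gives `4 * ε = 1/64`, below the failure probability `1/32`.
  set ε : ℝ≥0∞ := ENNReal.ofReal (1 / 256) with hε
  have hε0 : 0 < ε := by simp [hε]
  have hmem : {μ ∈ exch | ∃ ν ∈ exchOn (faceSumZero 2), dbar v μ ν < ε} ∈
      vagueNhds (exchOn (faceSumZero 2)) :=
    hle (mem_iInf_of_mem ε (mem_iInf_of_mem hε0 (mem_principal_self _)))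
  have : (𝓝[>] (0 : I)).NeBot := nhdsGT_neBot_of_exists_gt ⟨1, zero_lt_one⟩
  have ht : Tendsto productWalk (𝓝[>] 0) (vagueNhds (exchOn (faceSumZero 2))) := by
    refine tendsto_inf.2 ⟨?_, tendsto_principal.2 (.of_forall productWalk_mem_exch)⟩
    exact (continuous_productWalk.continuousAt.tendsto.mono_left nhdsWithin_le_nhds).mono_right
      (nhds_le_nhdsSet productWalk_zero_mem_exchOn)
  have hsmall : ∀ᶠ p : I in 𝓝[>] 0, (p : ℝ) < 1 / 2 := by
    refine nhdsWithin_le_nhds ?_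
    exact continuous_subtype_val.continuousAt.eventually_lt_const (by norm_num)
  have hpos : ∀ᶠ p : I in 𝓝[>] 0, 0 < p := self_mem_nhdsWithin
  obtain ⟨p, ⟨-, ν, hν, hd⟩, hp, hp'⟩ := ((ht.eventually hmem).and (hpos.and hsmall)).exists
  obtain ⟨a, b, hab⟩ := exists_productWalk_parallelogramFails hp hp'
  simp only [dbar, iInf_lt_iff] at hd
  obtain ⟨lam, hj, hlt⟩ := hd
  have h1 := hab.trans (measure_parallelogramFails_le hj hν v a b)
  have h2 : 4 * (lam : Measure (Config × Config)) {q | q.1 v ≠ q.2 v} ≤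
      ENNReal.ofReal (1 / 64) := by
    refine (mul_le_mul_right hlt.le 4).trans (le_of_eq ?_)
    rw [hε, show (4 : ℝ≥0∞) = ENNReal.ofReal 4 by simp, ← ENNReal.ofReal_mul (by norm_num)]
    norm_num
  have h3 := h1.trans h2
  rw [ENNReal.ofReal_le_ofReal_iff (by norm_num)] at h3
  norm_num at h3

theorem joiningNhds_lt_vagueNhds (v : Cube) :
    joiningNhds v (exchOn (faceSumZero 2)) < vagueNhds (exchOn (faceSumZero 2)) :=
  lt_of_le_not_ge (joiningNhds_le_vagueNhds v (isClosed_exchOn_faceSumZero 2))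
    (not_vagueNhds_le_joiningNhds v)

end CubeExch

theorem corollary5p2 :
    -- the joining neighbourhoods of the simplex are strictly finer than the vague ones
    (∀ v : Cube,
      joiningNhds v (exchOn (faceSumZero 2)) <
        vagueNhds (exchOn (faceSumZero 2))) ∧
    -- the members are the mixtures of the random walk examples and the two constants
    (∀ μ : ProbabilityMeasure Config,
      μ ∈ exchOn (faceSumZero 2) ↔
        ∃ (a b : ℝ≥0∞) (m : Measure I), a + b + m Set.univ = 1 ∧
          ∀ A : Set Config, MeasurableSet A →
            (μ : Measure Config) A =
              a * (diracConst 0 : Measure Config) A +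
              b * (diracConst 1 : Measure Config) A +
              ∫⁻ p, (randomWalk p : Measure Config) A ∂m) ∧
    -- the extreme points
    extremeMeasures (exchOn (faceSumZero 2)) =
      {diracConst 0, diracConst 1} ∪ randomWalk '' {p : I | 0 < p} ∧
    -- the only non-ergodic cluster point of the extreme points
    {μ : ProbabilityMeasure Config |
        AccPt μ (𝓟 (extremeMeasures (exchOn (faceSumZero 2)))) ∧
          ¬ IsErgodic μ} =
      {halfHalf} ∧
    -- the extreme points are not dense in the simplex
    ¬ exchOn (faceSumZero 2) ⊆
      closure (extremeMeasures (exchOn (faceSumZero 2))) := by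
  refine ⟨joiningNhds_lt_vagueNhds, fun μ => ?_, extremeMeasures_eq, nonergodic_accPt_eq,
    not_subset_closure_extremeMeasures⟩
  rw [mem_exchOn_iff_mixture]
  refine exists_congr fun a => exists_congr fun b => exists_congr fun m =>
    and_congr_right fun _ => ⟨fun h A hA => ?_, fun h => Measure.ext fun A hA => ?_⟩
  · rw [h, mixture_apply a b m hA]
  · rw [h A hA, mixture_apply a b m hA]
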